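/- Consider the linear Gaussian system $x_{k+1}=Ax_k+w_k$, $y_k=Cx_k+v_k$ with $A\in\mathbb R^{n\times n}$, $n\ge 1$, $C\in\mathbb R^{m\times n}$, $w_k\sim N(0,Q)$, $v_k\sim N(0,R)$, initial state covariance $\Sigma_0$, and $x_0,w_0,w_1,\dots,v_0,v_1,\dots$ mutually independent. The measurement $y_k$ arrives at the estimator if $\gamma_k=1$ and is lost if $\gamma_k=0$, where the $\gamma_k$ are i.i.d. Bernoulli, independent of the noises and of $x_0$, with $P(\gamma_k=1)=p$. The error covariance of the one-step Kalman predictor then satisfies $P_0=\Sigma_0$ and $$P_{k+1}=AP_kA^T+Q-\gamma_k\,AP_kC^T(CP_kC^T+R)^{-1}CP_kA^T .$$ Call $\mathbb E P_k$ bounded if there is $M\ge 0$ with $\mathbb E P_k\le M$ for all $k$ (in the positive semidefinite order), and unbounded otherwise. Assume (H1) $(C,A)$ is detectable; (H2) $A$ is diagonalizable over $\mathbb C$, $S^{-1}AS=\mathrm{diag}(\lambda_1,\dots,\lambda_n)$ with $|\lambda_1|\ge\dots\ge|\lambda_n|$; (H3) $R,Q,\Sigma_0$ are positive definite. Assume also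 that for every index set $I\subseteq\{1,\dots,n\}$ on which $|\lambda_i|$ is constant and at least $1$ (an equi-block associated to unstable or critically stable eigenvalues), the columns of $CS$ with index in $I$ form a matrix of full column rank (the equi-block is non-degenerate, i.e. one-step observable). Then the critical arrival probability is $$p_c=\max\left(1-|\lambda_1|^{-2},\,0\right),$$ read as $0$ if $\lambda_1=0$. That is, $0\le p_c<1$; for $p_c<p\le 1$, $\mathbb E P_k$ is bounded; for $0\le p<p_c$, and also for $p=p_c$ if $A$ is unstable ($|\lambda_1|>1$), $\mathbb E P_k$ is unbounded. Moreover, for the same value $p_c$, if the recursion is started from $P_0$ in place of $\Sigma_0$, then $\mathbb E P_k$ is bounded for every $P_0\ge 0$ when $p_c<p\le 1$, and unbounded for some $P_0\ge 0$ when $0\le p<p_c$, and also when $p=p_c$ if $A$ is unstable. -/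

import Mathlib

open MeasureTheory ProbabilityTheory
open scoped Matrix

noncomputable section

namespace IntermittentKalman

/-- A real matrix regarded as a complex one. -/
def toC {k l : ℕ} (M : Matrix (Fin k) (Fin l) ℝ) : Matrix (Fin k) (Fin l) ℂ :=
  M.map (algebraMap ℝ ℂ)

/-- `(C, A)` is detectable: some output injection `L` makes `A - L C` stable, i.e. puts all its
complex eigenvalues in the open unit disc. -/
def Detectable {n m : ℕ} (A : Matrix (Fin n) (Fin n) ℝ) (C : Matrix (Fin m) (Fin n) ℝ) : Prop :=
  ∃ L : Matrix (Fin n) (Fin m) ℝ, ∀ z ∈ spectrum ℂ (toC (A - L * C)), ‖z‖ < 1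

/-- `S` and `lam` diagonalize `A` over `ℂ`: `S` is invertible and `S⁻¹ A S = diag(lam)`. -/
def IsDiagonalization {n : ℕ} (A : Matrix (Fin n) (Fin n) ℝ) (S : Matrix (Fin n) (Fin n) ℂ)
    (lam : Fin n → ℂ) : Prop :=
  IsUnit S ∧ S⁻¹ * toC A * S = Matrix.diagonal lam

/-- The output matrix of the block with index set `I` of a system whose output matrix is `C`:
the columns of `C` with index in `I`. -/
def blockOutput {n m : ℕ} (C : Matrix (Fin m) (Fin n) ℂ) (I : Finset (Fin n)) :
    Matrix (Fin m) I ℂ :=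
  C.submatrix id (fun i => (i : Fin n))

/-- The index set `I` defines an equi-block of a system with state matrix `diag(lam)`. -/
def IsEquiBlock {n : ℕ} (lam : Fin n → ℂ) (I : Finset (Fin n)) : Prop :=
  ∀ i ∈ I, ∀ j ∈ I, ‖lam i‖ = ‖lam j‖

/-- A (sub)system with output matrix `C` is one-step observable: `C` has full column rank. -/
def OneStepObservable {m : ℕ} {ι : Type*} [Fintype ι] (C : Matrix (Fin m) ι ℂ) : Prop :=
  C.rank = Fintype.card ι

/-- `γ` is a sequence of i.i.d. Bernoulli random variables with `P(γ k = 1) = p`. -/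
structure IsBernoulliProcess {Ω : Type*} [MeasurableSpace Ω] (μ : Measure Ω) (p : ℝ)
    (γ : ℕ → Ω → ℝ) : Prop where
  measurable : ∀ k, Measurable (γ k)
  zero_or_one : ∀ k ω, γ k ω = 0 ∨ γ k ω = 1
  indep : iIndepFun γ μ
  prob_one : ∀ k, μ {ω | γ k ω = 1} = ENNReal.ofReal p

/-- The error covariance `P k` of the one-step Kalman predictor started at `P 0 = P₀`, along the
realization `g` of the arrival sequence. -/
def errorCov {n m : ℕ} (A : Matrix (Fin n) (Fin n) ℝ) (C : Matrix (Fin m) (Fin n) ℝ)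
    (Q : Matrix (Fin n) (Fin n) ℝ) (R : Matrix (Fin m) (Fin m) ℝ)
    (P₀ : Matrix (Fin n) (Fin n) ℝ) (g : ℕ → ℝ) : ℕ → Matrix (Fin n) (Fin n) ℝ
  | 0 => P₀
  | k + 1 =>
    let P := errorCov A C Q R P₀ g k
    A * P * Aᵀ + Q - g k • (A * P * Cᵀ * (C * P * Cᵀ + R)⁻¹ * C * P * Aᵀ)

/-- The expectation `E P k`, taken entrywise. -/
def meanErrorCov {n m : ℕ} (A : Matrix (Fin n) (Fin n) ℝ) (C : Matrix (Fin m) (Fin n) ℝ)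
    (Q : Matrix (Fin n) (Fin n) ℝ) (R : Matrix (Fin m) (Fin m) ℝ)
    (P₀ : Matrix (Fin n) (Fin n) ℝ) {Ω : Type*} [MeasurableSpace Ω] (μ : Measure Ω)
    (γ : ℕ → Ω → ℝ) (k : ℕ) : Matrix (Fin n) (Fin n) ℝ :=
  Matrix.of fun i j => ∫ ω, errorCov A C Q R P₀ (fun t => γ t ω) k i j ∂μ

/-- A sequence of symmetric matrices is bounded: some `M ≥ 0` dominates every term in the
Loewner order. -/
def LoewnerBounded {n : ℕ} (X : ℕ → Matrix (Fin n) (Fin n) ℝ) : Prop :=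
  ∃ M : Matrix (Fin n) (Fin n) ℝ, M.PosSemidef ∧ ∀ k, (M - X k).PosSemidef

/-- `E P k` is bounded in `k` for every i.i.d. Bernoulli arrival process of parameter `p`. -/
def MeanBounded.{u} {n m : ℕ} (A : Matrix (Fin n) (Fin n) ℝ) (C : Matrix (Fin m) (Fin n) ℝ)
    (Q : Matrix (Fin n) (Fin n) ℝ) (R : Matrix (Fin m) (Fin m) ℝ)
    (P₀ : Matrix (Fin n) (Fin n) ℝ) (p : ℝ) : Prop :=
  ∀ (Ω : Type u) [MeasurableSpace Ω] (μ : Measure Ω) [IsProbabilityMeasure μ] (γ : ℕ → Ω → ℝ),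
    IsBernoulliProcess μ p γ → LoewnerBounded (meanErrorCov A C Q R P₀ μ γ)

/-- `E P k` is unbounded in `k` for every i.i.d. Bernoulli arrival process of parameter `p`. -/
def MeanUnbounded.{u} {n m : ℕ} (A : Matrix (Fin n) (Fin n) ℝ) (C : Matrix (Fin m) (Fin n) ℝ)
    (Q : Matrix (Fin n) (Fin n) ℝ) (R : Matrix (Fin m) (Fin m) ℝ)
    (P₀ : Matrix (Fin n) (Fin n) ℝ) (p : ℝ) : Prop :=
  ∀ (Ω : Type u) [MeasurableSpace Ω] (μ : Measure Ω) [IsProbabilityMeasure μ] (γ : ℕ → Ω → ℝ),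
    IsBernoulliProcess μ p γ → ¬ LoewnerBounded (meanErrorCov A C Q R P₀ μ γ)

/-- `A` is unstable: it has a complex eigenvalue of modulus greater than one. -/
def IsUnstable {n : ℕ} (A : Matrix (Fin n) (Fin n) ℝ) : Prop :=
  ∃ z ∈ spectrum ℂ (toC A), 1 < ‖z‖

/-- `pc` is the critical arrival probability, relative to a class `init` of initial covariances:
below `pc` the mean error covariance is unbounded for some initial covariance in `init`, above
`pc` it is bounded for all of them; at `pc` itself it is unbounded for some of them if `A` is
unstable. -/
structure IsCriticalValue.{u} {n m : ℕ} (A : Matrix (Fin n) (Fin n) ℝ)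
    (C : Matrix (Fin m) (Fin n) ℝ) (Q : Matrix (Fin n) (Fin n) ℝ)
    (R : Matrix (Fin m) (Fin m) ℝ) (init : Set (Matrix (Fin n) (Fin n) ℝ)) (pc : ℝ) : Prop where
  nonneg : 0 ≤ pc
  lt_one : pc < 1
  unbounded_of_lt : ∀ p, 0 ≤ p → p < pc → ∃ P₀ ∈ init, MeanUnbounded.{u} A C Q R P₀ p
  unbounded_at : IsUnstable A → ∃ P₀ ∈ init, MeanUnbounded.{u} A C Q R P₀ pc
  bounded_of_gt : ∀ p, pc < p → p ≤ 1 → ∀ P₀ ∈ init, MeanBounded.{u} A C Q R P₀ p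

/-- `max (1 - |z|⁻², 0)`, where `|z|⁻²` is `+∞` for `z = 0`. -/
def criticalBound (z : ℂ) : ℝ :=
  if z = 0 then 0 else max (1 - 1 / ‖z‖ ^ 2) 0

end IntermittentKalman

end

/-! Lower bound: let `v` be a left eigenvector of `A` for the dominant eigenvalue `λ`. A loss
multiplies the form `v* P v` by `|λ|²` and adds noise, and an arrival still leaves at least `v* Q v
> 0`. So `v* P v` dominates a positive multiple of the sum over `s < k` of `|λ|^(2s)` times the
indicator that the last `s` packets were lost. Its mean is a sum of powers of `(1 - p)|λ|²`, which
diverges once this number is at least 1 (`le_quadForm_errorCov`, `meanUnbounded_of_eigenvector`).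

Upper bound: `zᵀ P z` is at most the quadratic cost of any control of the dual system, run backward
in time and actuated only at arrivals (`quadForm_errorCov_le`). Non-degeneracy of the equi-blocks
implies that a fixed number `H` of samples, at arbitrary times, determines the unstable modes with a
constant independent of those times (`exists_norm_part_le`). Dually, `H` arrivals among the last `s`
steps steer these modes to zero (`exists_dual_control`). With `κ = max(|λ|, 1)` the cost is `O((s +
1) κ^(2s))`, where `s` is the shortest past containing `H` arrivals. A Chernoff bound gives this `s`
a tail of rate `1 - (1 - ε)p`, arbitrarily close to `1 - p`, so the mean cost is a convergent series
whenever `(1 - p)κ² < 1` (`IsDiagonalization.meanBounded`). -/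

noncomputable section

namespace IntermittentKalman

/-! ### Quadratic forms and the Riccati step -/

section QuadForm

variable {n m : ℕ}

/-- The quadratic form `zᵀ P z`. -/
def quadForm (P : Matrix (Fin n) (Fin n) ℝ) (z : Fin n → ℝ) : ℝ := z ⬝ᵥ P *ᵥ z

lemma dotProduct_mulVec_comm {P : Matrix (Fin n) (Fin n) ℝ} (hP : Pᵀ = P) (x y : Fin n → ℝ) :
    x ⬝ᵥ P *ᵥ y = y ⬝ᵥ P *ᵥ x := by
  rw [Matrix.dotProduct_mulVec, ← Matrix.mulVec_transpose, hP, dotProduct_comm]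

lemma quadForm_add (P P' : Matrix (Fin n) (Fin n) ℝ) (z : Fin n → ℝ) :
    quadForm (P + P') z = quadForm P z + quadForm P' z := by
  simp [quadForm, Matrix.add_mulVec, dotProduct_add]

lemma quadForm_sub (P P' : Matrix (Fin n) (Fin n) ℝ) (z : Fin n → ℝ) :
    quadForm (P - P') z = quadForm P z - quadForm P' z := by
  simp [quadForm, Matrix.sub_mulVec, dotProduct_sub]

lemma quadForm_smul (c : ℝ) (P : Matrix (Fin n) (Fin n) ℝ) (z : Fin n → ℝ) :
    quadForm (c • P) z = c * quadForm P z := by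
  simp [quadForm, Matrix.smul_mulVec]

lemma quadForm_conj (A : Matrix (Fin n) (Fin m) ℝ) (P : Matrix (Fin m) (Fin m) ℝ)
    (z : Fin n → ℝ) : quadForm (A * P * Aᵀ) z = quadForm P (Aᵀ *ᵥ z) := by
  simp only [quadForm, ← Matrix.mulVec_mulVec]
  rw [Matrix.dotProduct_mulVec, ← Matrix.mulVec_transpose]

lemma quadForm_vec_sub {P : Matrix (Fin n) (Fin n) ℝ} (hP : Pᵀ = P) (x y : Fin n → ℝ) :
    quadForm P (x - y) = quadForm P x - 2 * (y ⬝ᵥ P *ᵥ x) + quadForm P y := by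
  simp only [quadForm, Matrix.mulVec_sub, dotProduct_sub, sub_dotProduct]
  rw [dotProduct_mulVec_comm hP x y]; ring

lemma _root_.Matrix.PosSemidef.quadForm_nonneg {P : Matrix (Fin n) (Fin n) ℝ} (hP : P.PosSemidef)
    (z : Fin n → ℝ) : 0 ≤ quadForm P z := by
  simpa [quadForm] using hP.dotProduct_mulVec_nonneg z

lemma _root_.Matrix.PosDef.quadForm_pos {P : Matrix (Fin n) (Fin n) ℝ} (hP : P.PosDef)
    {z : Fin n → ℝ} (hz : z ≠ 0) : 0 < quadForm P z := by
  simpa [quadForm] using hP.dotProduct_mulVec_pos hz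

lemma transpose_eq_of_isHermitian {P : Matrix (Fin n) (Fin n) ℝ} (hP : P.IsHermitian) :
    Pᵀ = P := by
  simpa [Matrix.conjTranspose_eq_transpose_of_trivial] using hP.eq

lemma posSemidef_of_quadForm_nonneg {P : Matrix (Fin n) (Fin n) ℝ} (hP : Pᵀ = P)
    (h : ∀ z, 0 ≤ quadForm P z) : P.PosSemidef := by
  refine Matrix.PosSemidef.of_dotProduct_mulVec_nonneg ?_ fun z => ?_
  · rw [Matrix.IsHermitian, Matrix.conjTranspose_eq_transpose_of_trivial, hP]
  · simpa [quadForm] using h z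

lemma quadForm_le_sq_norm (P : Matrix (Fin n) (Fin n) ℝ) :
    ∃ K : ℝ, 0 ≤ K ∧ ∀ z : Fin n → ℝ, quadForm P z ≤ K * ‖z‖ ^ 2 := by
  refine ⟨∑ i, ∑ j, |P i j|, by positivity, fun z => ?_⟩
  simp only [quadForm, dotProduct, Matrix.mulVec, Finset.mul_sum, Finset.sum_mul]
  refine Finset.sum_le_sum fun i _ => Finset.sum_le_sum fun j _ => ?_
  calc z i * (P i j * z j) ≤ |z i * (P i j * z j)| := le_abs_self _
    _ = |P i j| * (‖z i‖ * ‖z j‖) := by rw [abs_mul, abs_mul, Real.norm_eq_abs, Real.norm_eq_abs]; ring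
    _ ≤ |P i j| * (‖z‖ * ‖z‖) := by gcongr <;> exact norm_le_pi_norm z _
    _ = |P i j| * ‖z‖ ^ 2 := by ring

lemma posDef_innovation {C : Matrix (Fin m) (Fin n) ℝ} {P : Matrix (Fin n) (Fin n) ℝ}
    {R : Matrix (Fin m) (Fin m) ℝ} (hP : P.PosSemidef) (hR : R.PosDef) :
    (C * P * Cᵀ + R).PosDef := by
  have h := hP.mul_mul_conjTranspose_same C
  rw [Matrix.conjTranspose_eq_transpose_of_trivial] at h
  exact Matrix.PosDef.posSemidef_add h hR

/-- Completion of the square in the measurement update. -/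
lemma quadForm_complete_square {C : Matrix (Fin m) (Fin n) ℝ} {P : Matrix (Fin n) (Fin n) ℝ}
    {R : Matrix (Fin m) (Fin m) ℝ} (hP : P.PosSemidef) (hR : R.PosDef)
    (w : Fin n → ℝ) (u : Fin m → ℝ) :
    quadForm P (w - Cᵀ *ᵥ u) + quadForm R u =
      quadForm P w - quadForm (C * P * Cᵀ + R)⁻¹ (C *ᵥ P *ᵥ w) +
        quadForm (C * P * Cᵀ + R) (u - (C * P * Cᵀ + R)⁻¹ *ᵥ C *ᵥ P *ᵥ w) := by
  have hM := posDef_innovation (C := C) hP hR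
  have hMt := transpose_eq_of_isHermitian hM.isHermitian
  have hPt := transpose_eq_of_isHermitian hP.isHermitian
  set M := C * P * Cᵀ + R with hMdef
  have hMM : M *ᵥ M⁻¹ *ᵥ C *ᵥ P *ᵥ w = C *ᵥ P *ᵥ w := by
    rw [Matrix.mulVec_mulVec, Matrix.mul_nonsing_inv _ ((Matrix.isUnit_iff_isUnit_det _).1 hM.isUnit),
      Matrix.one_mulVec]
  rw [quadForm_vec_sub hPt, quadForm_vec_sub hMt]
  have h1 : quadForm M u = quadForm P (Cᵀ *ᵥ u) + quadForm R u := by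
    rw [hMdef, quadForm_add, quadForm_conj]
  have h2 : (Cᵀ *ᵥ u) ⬝ᵥ P *ᵥ w = u ⬝ᵥ C *ᵥ P *ᵥ w := by
    rw [Matrix.dotProduct_mulVec u C, Matrix.mulVec_transpose]
  have h3 : (M⁻¹ *ᵥ C *ᵥ P *ᵥ w) ⬝ᵥ M *ᵥ u = u ⬝ᵥ C *ᵥ P *ᵥ w := by
    rw [dotProduct_mulVec_comm hMt, hMM]
  have h4 : quadForm M (M⁻¹ *ᵥ C *ᵥ P *ᵥ w) = quadForm M⁻¹ (C *ᵥ P *ᵥ w) := by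
    rw [quadForm, hMM, quadForm, dotProduct_comm]
  rw [h1, h2, h3, h4]; ring

variable (A : Matrix (Fin n) (Fin n) ℝ) (C : Matrix (Fin m) (Fin n) ℝ)
  (Q : Matrix (Fin n) (Fin n) ℝ) (R : Matrix (Fin m) (Fin m) ℝ)

/-- One step of the Riccati recursion with arrival indicator `c`. -/
def riccatiStep (c : ℝ) (P : Matrix (Fin n) (Fin n) ℝ) : Matrix (Fin n) (Fin n) ℝ :=
  A * P * Aᵀ + Q - c • (A * P * Cᵀ * (C * P * Cᵀ + R)⁻¹ * C * P * Aᵀ)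

lemma errorCov_succ (P₀ : Matrix (Fin n) (Fin n) ℝ) (g : ℕ → ℝ) (k : ℕ) :
    errorCov A C Q R P₀ g (k + 1) = riccatiStep A C Q R (g k) (errorCov A C Q R P₀ g k) := rfl

variable {A C Q R} {P : Matrix (Fin n) (Fin n) ℝ}

lemma quadForm_riccatiStep (hP : P.PosSemidef) (c : ℝ) (z : Fin n → ℝ) :
    quadForm (riccatiStep A C Q R c P) z = quadForm P (Aᵀ *ᵥ z) + quadForm Q z -
      c * quadForm (C * P * Cᵀ + R)⁻¹ (C *ᵥ P *ᵥ Aᵀ *ᵥ z) := by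
  have hPt := transpose_eq_of_isHermitian hP.isHermitian
  rw [riccatiStep, quadForm_sub, quadForm_add, quadForm_smul, quadForm_conj]
  have : A * P * Cᵀ * (C * P * Cᵀ + R)⁻¹ * C * P * Aᵀ =
      (A * P * Cᵀ) * (C * P * Cᵀ + R)⁻¹ * (A * P * Cᵀ)ᵀ := by
    simp only [Matrix.transpose_mul, Matrix.transpose_transpose, hPt, Matrix.mul_assoc]
  rw [this, quadForm_conj]
  simp only [Matrix.transpose_mul, Matrix.transpose_transpose, hPt, ← Matrix.mulVec_mulVec]

/-- The Kalman gain is optimal: replacing it by an arbitrary `u` adds the nonnegative square from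
`quadForm_complete_square`. -/
lemma quadForm_riccatiStep_one_le (hP : P.PosSemidef) (hR : R.PosDef) (z : Fin n → ℝ)
    (u : Fin m → ℝ) :
    quadForm (riccatiStep A C Q R 1 P) z ≤
      quadForm P (Aᵀ *ᵥ z - Cᵀ *ᵥ u) + quadForm Q z + quadForm R u := by
  have h := quadForm_complete_square (C := C) hP hR (Aᵀ *ᵥ z) u
  have h' := (posDef_innovation (C := C) hP hR).posSemidef.quadForm_nonneg
    (u - (C * P * Cᵀ + R)⁻¹ *ᵥ C *ᵥ P *ᵥ Aᵀ *ᵥ z)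
  rw [quadForm_riccatiStep hP]
  linarith

lemma le_quadForm_riccatiStep_one (hP : P.PosSemidef) (hR : R.PosDef) (z : Fin n → ℝ) :
    quadForm Q z ≤ quadForm (riccatiStep A C Q R 1 P) z := by
  -- At the optimal input the last square vanishes, so the updated form is itself a sum of
  -- nonnegative terms.
  have h := quadForm_complete_square (C := C) hP hR (Aᵀ *ᵥ z)
    ((C * P * Cᵀ + R)⁻¹ *ᵥ C *ᵥ P *ᵥ Aᵀ *ᵥ z)
  rw [sub_self, show quadForm (C * P * Cᵀ + R) 0 = 0 by simp [quadForm]] at h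
  have h1 := hP.quadForm_nonneg
    (Aᵀ *ᵥ z - Cᵀ *ᵥ (C * P * Cᵀ + R)⁻¹ *ᵥ C *ᵥ P *ᵥ Aᵀ *ᵥ z)
  have h2 := hR.posSemidef.quadForm_nonneg ((C * P * Cᵀ + R)⁻¹ *ᵥ C *ᵥ P *ᵥ Aᵀ *ᵥ z)
  rw [quadForm_riccatiStep hP]
  linarith

lemma le_quadForm_riccatiStep (hP : P.PosSemidef) (hR : R.PosDef) {c : ℝ} (hc : c = 0 ∨ c = 1)
    (z : Fin n → ℝ) :
    (1 - c) * quadForm P (Aᵀ *ᵥ z) + quadForm Q z ≤ quadForm (riccatiStep A C Q R c P) z := by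
  rcases hc with rfl | rfl
  · rw [quadForm_riccatiStep hP]; linarith
  · simpa using le_quadForm_riccatiStep_one hP hR z

lemma posSemidef_riccatiStep (hP : P.PosSemidef) (hQ : Q.PosSemidef) (hR : R.PosDef) {c : ℝ}
    (hc : c = 0 ∨ c = 1) : (riccatiStep A C Q R c P).PosSemidef := by
  have hPt := transpose_eq_of_isHermitian hP.isHermitian
  have hQt := transpose_eq_of_isHermitian hQ.isHermitian
  have hMt := transpose_eq_of_isHermitian (posDef_innovation (C := C) hP hR).isHermitian
  refine posSemidef_of_quadForm_nonneg ?_ fun z => ?_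
  · rw [riccatiStep, Matrix.transpose_sub, Matrix.transpose_add, Matrix.transpose_smul, hQt]
    simp only [Matrix.transpose_mul, Matrix.transpose_transpose, hPt, Matrix.transpose_nonsing_inv,
      hMt]
    simp only [Matrix.mul_assoc]
  · refine le_trans ?_ (le_quadForm_riccatiStep hP hR hc z)
    have h1 := hP.quadForm_nonneg (Aᵀ *ᵥ z)
    have h2 := hQ.quadForm_nonneg z
    rcases hc with rfl | rfl <;> simp <;> linarith

variable {P₀ : Matrix (Fin n) (Fin n) ℝ} {g : ℕ → ℝ}

lemma posSemidef_errorCov (hP₀ : P₀.PosSemidef) (hQ : Q.PosSemidef) (hR : R.PosDef)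
    (hg : ∀ t, g t = 0 ∨ g t = 1) (k : ℕ) : (errorCov A C Q R P₀ g k).PosSemidef := by
  induction k with
  | zero => exact hP₀
  | succ k ih => exact posSemidef_riccatiStep ih hQ hR (hg k)

/-- The error covariance is dominated by the cost of any control of the dual system. -/
lemma quadForm_errorCov_le (hP₀ : P₀.PosSemidef) (hQ : Q.PosSemidef) (hR : R.PosDef)
    (hg : ∀ t, g t = 0 ∨ g t = 1) (k : ℕ) (z : ℕ → Fin n → ℝ) (u : ℕ → Fin m → ℝ)
    (hz : ∀ t < k, z t = Aᵀ *ᵥ z (t + 1) - g t • Cᵀ *ᵥ u t) :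
    quadForm (errorCov A C Q R P₀ g k) (z k) ≤
      quadForm P₀ (z 0) + ∑ t ∈ Finset.range k, (quadForm Q (z (t + 1)) + g t * quadForm R (u t)) := by
  induction k with
  | zero => simp [errorCov]
  | succ k ih =>
    have ih' := ih fun t ht => hz t (by omega)
    rw [Finset.sum_range_succ, errorCov_succ]
    have hP := posSemidef_errorCov (A := A) (C := C) hP₀ hQ hR hg k
    have hzk := hz k (by omega)
    -- At a loss the input has no effect and the step is exact; at an arrival the given input is
    -- merely suboptimal.
    rcases hg k with h | h <;> rw [h] at hzk ⊢
    · rw [quadForm_riccatiStep hP]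
      simp only [zero_smul, sub_zero] at hzk
      rw [← hzk]; linarith
    · have h3 := quadForm_riccatiStep_one_le (A := A) (C := C) (Q := Q) hP hR (z (k + 1)) (u k)
      rw [one_smul] at hzk
      rw [← hzk] at h3; linarith

/-- Along the real and imaginary parts `a`, `b` of a left eigenvector of `A` with eigenvalue
`α + β i`, the error covariance collects the noise of every loss-free past. -/
lemma le_quadForm_errorCov (hP₀ : P₀.PosSemidef) (hQ : Q.PosSemidef) (hR : R.PosDef)
    (hg : ∀ t, g t = 0 ∨ g t = 1) {a b : Fin n → ℝ} {α β : ℝ}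
    (ha : Aᵀ *ᵥ a = α • a - β • b) (hb : Aᵀ *ᵥ b = β • a + α • b) (k : ℕ) :
    (quadForm Q a + quadForm Q b) *
        ∑ s ∈ Finset.range k, (α ^ 2 + β ^ 2) ^ s * ∏ t ∈ Finset.Ico (k - s) k, (1 - g t) ≤
      quadForm (errorCov A C Q R P₀ g k) a + quadForm (errorCov A C Q R P₀ g k) b := by
  induction k with
  | zero =>
    have := hP₀.quadForm_nonneg a
    have := hP₀.quadForm_nonneg b
    simp [errorCov]; linarith
  | succ k ih =>
    have hP := posSemidef_errorCov (A := A) (C := C) hP₀ hQ hR hg k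
    have hPt := transpose_eq_of_isHermitian hP.isHermitian
    have h1 := le_quadForm_riccatiStep (A := A) (C := C) (Q := Q) hP hR (hg k) a
    have h2 := le_quadForm_riccatiStep (A := A) (C := C) (Q := Q) hP hR (hg k) b
    rw [errorCov_succ]
    set P := errorCov A C Q R P₀ g k
    -- On the pair `(a, b)` the map `Aᵀ` is a scaled rotation, so the cross terms cancel in the sum.
    have h3 : quadForm P (Aᵀ *ᵥ a) + quadForm P (Aᵀ *ᵥ b) =
        (α ^ 2 + β ^ 2) * (quadForm P a + quadForm P b) := by
      rw [ha, hb]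
      simp only [quadForm, Matrix.mulVec_sub, Matrix.mulVec_add, Matrix.mulVec_smul,
        dotProduct_sub, sub_dotProduct, dotProduct_add, add_dotProduct, dotProduct_smul,
        smul_dotProduct, smul_eq_mul]
      rw [dotProduct_mulVec_comm hPt b a]; ring
    have hg1 : 0 ≤ 1 - g k := by rcases hg k with h | h <;> rw [h] <;> norm_num
    have h4 : ∑ s ∈ Finset.range (k + 1), (α ^ 2 + β ^ 2) ^ s *
        ∏ t ∈ Finset.Ico (k + 1 - s) (k + 1), (1 - g t) =
        (1 - g k) * (α ^ 2 + β ^ 2) * (∑ s ∈ Finset.range k, (α ^ 2 + β ^ 2) ^ s *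
          ∏ t ∈ Finset.Ico (k - s) k, (1 - g t)) + 1 := by
      rw [Finset.sum_range_succ', Finset.mul_sum]
      congr 1
      · refine Finset.sum_congr rfl fun s hs => ?_
        rw [show k + 1 - (s + 1) = k - s by omega, Finset.prod_Ico_succ_top (by omega)]
        ring
      · simp
    rw [h4]
    have h5 := mul_le_mul_of_nonneg_left ih (mul_nonneg hg1 (by positivity : 0 ≤ α ^ 2 + β ^ 2))
    nlinarith [h5, h1, h2, h3]

end QuadForm

/-! ### Expectations over the arrival process -/

section Expectation

variable {n m : ℕ} {Ω : Type*} [MeasurableSpace Ω] {μ : Measure Ω}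
  {p : ℝ} {γ : ℕ → Ω → ℝ}

lemma IsBernoulliProcess.integral_eq (hγ : IsBernoulliProcess μ p γ) (hp : 0 ≤ p) (k : ℕ) :
    ∫ ω, γ k ω ∂μ = p := by
  have hs : MeasurableSet {ω | γ k ω = 1} := hγ.measurable k (measurableSet_singleton 1)
  have : γ k = {ω | γ k ω = 1}.indicator fun _ => (1 : ℝ) := by
    ext ω
    rcases hγ.zero_or_one k ω with h | h <;> simp [Set.indicator, h]
  rw [this, integral_indicator_const _ hs, measureReal_def, hγ.prob_one k]
  simp [hp]

variable [IsProbabilityMeasure μ]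

lemma IsBernoulliProcess.integrable (hγ : IsBernoulliProcess μ p γ) (k : ℕ) :
    Integrable (γ k) μ := by
  refine Integrable.of_bound (hγ.measurable k).aestronglyMeasurable 1 (ae_of_all _ fun ω => ?_)
  rcases hγ.zero_or_one k ω with h | h <;> simp [h]

/-- One formula serves both halves: `a = 1` gives the probability of a run of losses, `a = 1 - ε`
the generating function of the number of arrivals. -/
lemma IsBernoulliProcess.integral_prod (hγ : IsBernoulliProcess μ p γ) (hp : 0 ≤ p) (a : ℝ)
    (T : Finset ℕ) : ∫ ω, ∏ t ∈ T, (1 - a * γ t ω) ∂μ = (1 - a * p) ^ T.card := by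
  have hind := hγ.indep.precomp (g := ((↑) : T → ℕ)) Subtype.val_injective
  have h := hind.integral_fun_prod_comp (f := fun _ x => 1 - a * x)
    (fun i => (hγ.measurable i).aemeasurable)
    (fun i => (by fun_prop : Measurable fun x : ℝ => 1 - a * x).aestronglyMeasurable)
  have h' : ∀ ω, ∏ t ∈ T, (1 - a * γ t ω) = ∏ i : T, (1 - a * γ i ω) := fun ω =>
    (Finset.prod_coe_sort T fun t => 1 - a * γ t ω).symm
  simp_rw [h']
  rw [h]
  have : ∀ i : T, ∫ ω, (1 - a * γ i ω) ∂μ = 1 - a * p := fun i => by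
    rw [integral_sub (integrable_const _) ((hγ.integrable i).const_mul a), integral_const_mul,
      hγ.integral_eq hp]
    simp
  simp [this]

lemma IsBernoulliProcess.integrable_prod (hγ : IsBernoulliProcess μ p γ) (a : ℝ)
    (T : Finset ℕ) : Integrable (fun ω => ∏ t ∈ T, (1 - a * γ t ω)) μ := by
  have hm : Measurable fun ω => ∏ t ∈ T, (1 - a * γ t ω) :=
    Finset.measurable_fun_prod T fun t _ => ((hγ.measurable t).const_mul a).const_sub 1
  refine Integrable.of_bound hm.aestronglyMeasurable (∏ t ∈ T, (1 + |a|))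
    (ae_of_all _ fun ω => ?_)
  rw [norm_prod]
  refine Finset.prod_le_prod (fun _ _ => norm_nonneg _) fun t _ => ?_
  rcases hγ.zero_or_one t ω with h | h
  · simp [h]
  · rw [h, mul_one]
    exact (norm_sub_le _ _).trans (by simp)

variable (A : Matrix (Fin n) (Fin n) ℝ) (C : Matrix (Fin m) (Fin n) ℝ)
  (Q : Matrix (Fin n) (Fin n) ℝ) (R : Matrix (Fin m) (Fin m) ℝ) (P₀ : Matrix (Fin n) (Fin n) ℝ)

lemma errorCov_congr {g g' : ℕ → ℝ} {k : ℕ} (h : ∀ t < k, g t = g' t) :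
    errorCov A C Q R P₀ g k = errorCov A C Q R P₀ g' k := by
  induction k with
  | zero => rfl
  | succ k ih => rw [errorCov_succ, errorCov_succ, ih fun t ht => h t (by omega), h k (by omega)]

/-- Only the first `k` arrival indicators enter, so the random variable factors through a finite
set; it is then measurable and bounded without any estimate on the recursion. -/
lemma IsBernoulliProcess.integrable_errorCov (hγ : IsBernoulliProcess μ p γ) (k : ℕ)
    (i j : Fin n) : Integrable (fun ω => errorCov A C Q R P₀ (fun t => γ t ω) k i j) μ := by
  let arrivals : Ω → Finset.range k → Bool := fun ω t => if γ t ω = 1 then true else false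
  let f : (Finset.range k → Bool) → ℝ := fun b =>
    errorCov A C Q R P₀ (fun t => if h : t ∈ Finset.range k then if b ⟨t, h⟩ then 1 else 0 else 0)
      k i j
  have hm : Measurable arrivals := measurable_pi_lambda _ fun t =>
    Measurable.ite (hγ.measurable t (measurableSet_singleton 1)) measurable_const measurable_const
  have hf : (fun ω => errorCov A C Q R P₀ (fun t => γ t ω) k i j) = f ∘ arrivals := by
    ext ω
    simp only [Function.comp, f, arrivals]
    rw [errorCov_congr]
    intro t ht
    rcases hγ.zero_or_one t ω with h | h <;> simp [h, ht]
  rw [hf]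
  refine Integrable.of_bound ((measurable_of_finite f).comp hm).aestronglyMeasurable
    (∑ b, ‖f b‖) (ae_of_all _ fun ω => ?_)
  exact Finset.single_le_sum (f := fun b => ‖f b‖) (fun _ _ => norm_nonneg _) (Finset.mem_univ _)

lemma IsBernoulliProcess.integrable_quadForm (hγ : IsBernoulliProcess μ p γ) (k : ℕ)
    (z : Fin n → ℝ) :
    Integrable (fun ω => quadForm (errorCov A C Q R P₀ (fun t => γ t ω) k) z) μ := by
  simp only [quadForm, dotProduct, Matrix.mulVec]
  exact integrable_finsetSum _ fun i _ => Integrable.const_mul (integrable_finsetSum _ fun j _ =>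
    (hγ.integrable_errorCov A C Q R P₀ k i j).mul_const _) _

lemma IsBernoulliProcess.quadForm_meanErrorCov (hγ : IsBernoulliProcess μ p γ) (k : ℕ)
    (z : Fin n → ℝ) : quadForm (meanErrorCov A C Q R P₀ μ γ k) z =
      ∫ ω, quadForm (errorCov A C Q R P₀ (fun t => γ t ω) k) z ∂μ := by
  have hint := hγ.integrable_errorCov A C Q R P₀ k
  simp only [quadForm, dotProduct, Matrix.mulVec]
  rw [integral_finsetSum _ fun i _ => Integrable.const_mul (integrable_finsetSum _ fun j _ =>
    (hint i j).mul_const _) _]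
  refine Finset.sum_congr rfl fun i _ => ?_
  rw [integral_const_mul, integral_finsetSum _ fun j _ => (hint i j).mul_const _]
  congr 1
  refine Finset.sum_congr rfl fun j _ => ?_
  rw [integral_mul_const, meanErrorCov, Matrix.of_apply]

variable {A C Q R P₀}

lemma loewnerBounded_of_quadForm_le (hγ : IsBernoulliProcess μ p γ) (hP₀ : P₀.PosSemidef)
    (hQ : Q.PosSemidef) (hR : R.PosDef) {K : ℝ} (hK : 0 ≤ K)
    (h : ∀ k z, ∫ ω, quadForm (errorCov A C Q R P₀ (fun t => γ t ω) k) z ∂μ ≤ K * ‖z‖ ^ 2) :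
    LoewnerBounded (meanErrorCov A C Q R P₀ μ γ) := by
  have hone : ∀ z : Fin n → ℝ, ‖z‖ ^ 2 ≤ quadForm 1 z := fun z => by
    have hz : quadForm 1 z = ∑ i, z i ^ 2 := by simp [quadForm, dotProduct, sq]
    rw [hz]
    have : ‖z‖ ≤ Real.sqrt (∑ i, z i ^ 2) := by
      refine (pi_norm_le_iff_of_nonneg (Real.sqrt_nonneg _)).2 fun i => Real.le_sqrt_of_sq_le ?_
      rw [Real.norm_eq_abs, sq_abs]
      exact Finset.single_le_sum (f := fun i => z i ^ 2) (fun _ _ => sq_nonneg _)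
        (Finset.mem_univ i)
    calc ‖z‖ ^ 2 ≤ Real.sqrt (∑ i, z i ^ 2) ^ 2 := by gcongr
      _ = _ := Real.sq_sqrt (Finset.sum_nonneg fun _ _ => sq_nonneg _)
  refine ⟨K • 1, Matrix.PosSemidef.one.smul hK, fun k => posSemidef_of_quadForm_nonneg ?_ ?_⟩
  · have : (meanErrorCov A C Q R P₀ μ γ k)ᵀ = meanErrorCov A C Q R P₀ μ γ k := by
      ext i j
      simp only [Matrix.transpose_apply, meanErrorCov, Matrix.of_apply]
      congr 1
      ext ω
      exact (posSemidef_errorCov hP₀ hQ hR (fun t => hγ.zero_or_one t ω) k).isHermitian.apply i j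
    rw [Matrix.transpose_sub, Matrix.transpose_smul, Matrix.transpose_one, this]
  · intro z
    rw [quadForm_sub, quadForm_smul, hγ.quadForm_meanErrorCov, sub_nonneg]
    exact (h k z).trans (by gcongr; exact hone z)

/-- Below and at the critical value the mean error covariance is unbounded. -/
lemma meanUnbounded_of_eigenvector.{u} (hP₀ : P₀.PosSemidef) (hQ : Q.PosDef) (hR : R.PosDef)
    {a b : Fin n → ℝ} (hab : a ≠ 0 ∨ b ≠ 0) {α β : ℝ}
    (ha : Aᵀ *ᵥ a = α • a - β • b) (hb : Aᵀ *ᵥ b = β • a + α • b)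
    (hp : 0 ≤ p) (hpc : 1 ≤ (1 - p) * (α ^ 2 + β ^ 2)) :
    MeanUnbounded.{u} A C Q R P₀ p := by
  rintro Ω _ μ _ γ hγ ⟨M, hM, hle⟩
  have hc : 0 < quadForm Q a + quadForm Q b := by
    have h1 := hQ.posSemidef.quadForm_nonneg a
    have h2 := hQ.posSemidef.quadForm_nonneg b
    rcases hab with h | h
    · linarith [hQ.quadForm_pos h]
    · linarith [hQ.quadForm_pos h]
  set c := quadForm Q a + quadForm Q b
  have key : ∀ k : ℕ, c * k ≤ quadForm M a + quadForm M b := fun k => by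
    have h1 := (hle k).quadForm_nonneg a
    have h2 := (hle k).quadForm_nonneg b
    rw [quadForm_sub, hγ.quadForm_meanErrorCov] at h1 h2
    have h3 : ∫ ω, c * ∑ s ∈ Finset.range k, (α ^ 2 + β ^ 2) ^ s *
        ∏ t ∈ Finset.Ico (k - s) k, (1 - 1 * γ t ω) ∂μ ≤
        ∫ ω, (quadForm (errorCov A C Q R P₀ (fun t => γ t ω) k) a +
          quadForm (errorCov A C Q R P₀ (fun t => γ t ω) k) b) ∂μ := by
      refine integral_mono ?_ ?_ fun ω => ?_
      · exact Integrable.const_mul (integrable_finsetSum _ fun s _ =>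
          (hγ.integrable_prod 1 _).const_mul _) _
      · exact (hγ.integrable_quadForm A C Q R P₀ k a).add (hγ.integrable_quadForm A C Q R P₀ k b)
      · simpa using le_quadForm_errorCov (C := C) hP₀ hQ.posSemidef hR
          (fun t => hγ.zero_or_one t ω) ha hb k
    rw [integral_add (hγ.integrable_quadForm A C Q R P₀ k a)
      (hγ.integrable_quadForm A C Q R P₀ k b), integral_const_mul,
      integral_finsetSum _ fun s _ => (hγ.integrable_prod 1 _).const_mul _] at h3
    -- The `s`-th term integrates to `((1 - p)(α² + β²))^s`, which is at least 1.
    have h4 : (k : ℝ) ≤ ∑ s ∈ Finset.range k, ∫ ω, (α ^ 2 + β ^ 2) ^ s *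
        ∏ t ∈ Finset.Ico (k - s) k, (1 - 1 * γ t ω) ∂μ := by
      calc (k : ℝ) = ∑ s ∈ Finset.range k, (1 : ℝ) := by simp
        _ ≤ _ := by
          refine Finset.sum_le_sum fun s hs => ?_
          have hs' := Finset.mem_range.1 hs
          rw [integral_const_mul, hγ.integral_prod hp, Nat.card_Ico, Nat.sub_sub_self hs'.le,
            ← mul_pow, one_mul, mul_comm]
          exact one_le_pow₀ hpc
    have h5 := mul_le_mul_of_nonneg_left h4 hc.le
    linarith
  obtain ⟨k, hk⟩ := exists_nat_gt ((quadForm M a + quadForm M b) / c)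
  rw [div_lt_iff₀ hc] at hk
  linarith [key k]

end Expectation

/-! ### Uniform observability from sparse samples -/

section Observability

variable {n m : ℕ}

/-- The vector `x` with the coordinates outside `U` set to zero. -/
def part (U : Finset (Fin n)) (x : Fin n → ℂ) : Fin n → ℂ := fun i => if i ∈ U then x i else 0

/-- The state at time `t` of the diagonal system started at `x`. -/
def flow (lam : Fin n → ℂ) (t : ℕ) (x : Fin n → ℂ) : Fin n → ℂ := fun i => lam i ^ t * x i

lemma norm_part_le_iff {U : Finset (Fin n)} {x : Fin n → ℂ} {a : ℝ} (ha : 0 ≤ a) :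
    ‖part U x‖ ≤ a ↔ ∀ i ∈ U, ‖x i‖ ≤ a := by
  rw [pi_norm_le_iff_of_nonneg ha]
  refine ⟨fun h i hi => by simpa [part, hi] using h i, fun h i => ?_⟩
  by_cases hi : i ∈ U
  · simpa [part, hi] using h i hi
  · simpa [part, hi] using ha

lemma norm_le_norm_part {U : Finset (Fin n)} (x : Fin n → ℂ) {i : Fin n} (hi : i ∈ U) :
    ‖x i‖ ≤ ‖part U x‖ :=
  (norm_part_le_iff (norm_nonneg _)).1 le_rfl i hi

lemma exists_norm_mulVec_le {α β : Type*} [Fintype α] [Fintype β] (M : Matrix α β ℂ) :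
    ∃ B : ℝ, 0 ≤ B ∧ ∀ v, ‖M *ᵥ v‖ ≤ B * ‖v‖ :=
  ⟨‖M.mulVecLin.toContinuousLinearMap‖, norm_nonneg _,
    fun v => M.mulVecLin.toContinuousLinearMap.le_opNorm v⟩

/-- Full column rank means trivial kernel, and an injective linear map in finite dimension is
bounded below. -/
lemma OneStepObservable.exists_norm_le {C : Matrix (Fin m) (Fin n) ℂ} {I : Finset (Fin n)}
    (h : OneStepObservable (blockOutput C I)) :
    ∃ L : ℝ, 0 ≤ L ∧ ∀ x, ‖part I x‖ ≤ L * ‖C *ᵥ part I x‖ := by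
  have hker : (blockOutput C I).mulVecLin.ker = ⊥ := by
    have h1 := (blockOutput C I).mulVecLin.finrank_range_add_finrank_ker
    have h2 : Module.finrank ℂ (blockOutput C I).mulVecLin.range = Fintype.card I := h
    rw [h2, Module.finrank_fintype_fun_eq_card] at h1
    exact Submodule.finrank_eq_zero.1 (by omega)
  obtain ⟨L, -, hL⟩ := LinearMap.exists_antilipschitzWith _ hker
  refine ⟨L, L.2, fun x => ?_⟩
  have h3 := hL.le_mul_dist (fun i : I => x i) 0
  have h4 : (blockOutput C I).mulVecLin (fun i : I => x i) = C *ᵥ part I x := by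
    ext j
    simp only [Matrix.mulVecLin_apply, Matrix.mulVec, dotProduct, blockOutput, part,
      Matrix.submatrix_apply, id, mul_ite, mul_zero]
    rw [← Finset.sum_filter, Finset.filter_mem_eq_inter, Finset.univ_inter]
    exact Finset.sum_coe_sort I fun i => C j i * x i
  rw [map_zero, dist_zero_right, dist_zero_right, h4] at h3
  refine le_trans ?_ h3
  exact (norm_part_le_iff (norm_nonneg _)).2 fun i hi =>
    norm_le_pi_norm (fun i : I => x i) ⟨i, hi⟩

variable {C : Matrix (Fin m) (Fin n) ℂ} {lam : Fin n → ℂ}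

lemma exists_gap {r : ℝ} {U : Finset (Fin n)} (h : ∀ i ∈ U, r < ‖lam i‖) :
    ∃ r' > r, ∀ i ∈ U, r' ≤ ‖lam i‖ := by
  rcases U.eq_empty_or_nonempty with rfl | hU
  · exact ⟨r + 1, by linarith, by simp⟩
  · obtain ⟨i, hi, hmin⟩ := U.exists_min_image (fun i => ‖lam i‖) hU
    exact ⟨‖lam i‖, h i hi, hmin⟩

/-- Fast modes at a sampling time are determined, up to the slower modes, by the samples. -/
lemma exists_norm_part_le
    (hobs : ∀ I : Finset (Fin n), IsEquiBlock lam I → (∀ i ∈ I, 1 ≤ ‖lam i‖) →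
      OneStepObservable (blockOutput C I))
    (U : Finset (Fin n)) (hU : ∀ i ∈ U, 1 ≤ ‖lam i‖)
    (hup : ∀ i ∈ U, ∀ j ∉ U, ‖lam j‖ < ‖lam i‖) :
    ∃ (H : ℕ) (K : ℝ), 0 ≤ K ∧ ∀ T : Finset ℕ, H ≤ T.card → ∀ s ∈ T, (∀ t ∈ T, s ≤ t) → ∀ x,
      ‖part U (flow lam s x)‖ ≤
        K * (∑ t ∈ T, ‖C *ᵥ flow lam t x‖ + ‖part Uᶜ (flow lam s x)‖) := by
  induction U using Finset.strongInduction with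
  | H U ih =>
  rcases U.eq_empty_or_nonempty with rfl | hne
  · refine ⟨0, 0, le_rfl, fun T _ s _ _ x => ?_⟩
    rw [zero_mul, norm_part_le_iff le_rfl]
    simp
  -- Peel off the slowest equi-block `I` of `U`; the strictly faster modes `U'` are handled by
  -- induction.
  obtain ⟨i₀, hi₀, hmin⟩ := U.exists_min_image (fun i => ‖lam i‖) hne
  set r := ‖lam i₀‖ with hr
  have hr1 : 1 ≤ r := hU i₀ hi₀
  set I := U.filter fun i => ‖lam i‖ = r with hI
  set U' := U.filter fun i => ‖lam i‖ ≠ r with hU'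
  have hgt : ∀ i ∈ U', r < ‖lam i‖ := fun i hi => by
    rw [hU', Finset.mem_filter] at hi
    exact lt_of_le_of_ne (hmin i hi.1) (Ne.symm hi.2)
  have hle : ∀ j ∉ U', ‖lam j‖ ≤ r := fun j hj => by
    by_cases hjU : j ∈ U
    · have : ‖lam j‖ = r := by
        by_contra h
        exact hj (Finset.mem_filter.2 ⟨hjU, h⟩)
      exact this.le
    · exact (hup i₀ hi₀ j hjU).le
  have hss : U' ⊂ U := Finset.filter_ssubset.2 ⟨i₀, hi₀, by simp [hr]⟩
  obtain ⟨H', K', hK', hIH⟩ := ih U' hss (fun i hi => hU i (hss.1 hi))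
    fun i hi j hj => (hle j hj).trans_lt (hgt i hi)
  obtain ⟨r', hr', hgap⟩ := exists_gap hgt
  obtain ⟨L, hL, hLI⟩ := (hobs I
    (fun i hi j hj => ((Finset.mem_filter.1 hi).2.trans (Finset.mem_filter.1 hj).2.symm))
    (fun i hi => hU i (Finset.mem_filter.1 hi).1)).exists_norm_le
  obtain ⟨B, hB, hCB⟩ := exists_norm_mulVec_le C
  have hr'0 : 0 < r' := by linarith
  set ρ := r / r' with hρ
  have hρ0 : 0 ≤ ρ := by positivity
  have hρ1 : ρ < 1 := (div_lt_one hr'0).2 hr'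
  -- The estimates of `U'` and `I` each involve the other block. Estimating `U'` at a time at least
  -- `D` later makes the loop gain at most 1/2, so it can be absorbed.
  obtain ⟨D, hD⟩ : ∃ D : ℕ, L * B * K' * ρ ^ D ≤ 1 / 2 := by
    have h := (tendsto_pow_atTop_nhds_zero_of_lt_one hρ0 hρ1).const_mul (L * B * K')
    rw [mul_zero] at h
    exact (h.eventually (ge_mem_nhds (by norm_num))).exists
  -- At most `D` samples lie within `D` steps of `s`; discarding them leaves `H'` for the induction
  -- hypothesis and one more to keep the set nonempty.
  refine ⟨H' + D + 1, K' + (K' + 1) * (2 * L * (1 + B * K') + (1 + 2 * L * B)) + K', by positivity,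
    fun T hT s hs hsmin x => ?_⟩
  set T' := T.filter fun t => s + D ≤ t with hT'
  have hcard : H' + 1 ≤ T'.card := by
    have h1 := Finset.card_filter_add_card_filter_not (s := T) (fun t => s + D ≤ t)
    have h2 : (T.filter fun t => ¬ s + D ≤ t).card ≤ D := by
      have : (T.filter fun t => ¬ s + D ≤ t) ⊆ Finset.Ico s (s + D) := fun t ht => by
        rw [Finset.mem_filter] at ht
        exact Finset.mem_Ico.2 ⟨hsmin t ht.1, by omega⟩
      simpa using Finset.card_le_card this
    rw [← hT'] at h1
    omega
  have hT'ne : T'.Nonempty := Finset.card_pos.1 (by omega)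
  obtain ⟨s', hs', hs'min⟩ := T'.exists_min_image id hT'ne
  have hτ : s + D ≤ s' := (Finset.mem_filter.1 hs').2
  obtain ⟨τ, rfl⟩ : ∃ τ, s' = s + τ := ⟨s' - s, by omega⟩
  have hDτ : D ≤ τ := by omega
  have hI' := hIH T' (by omega) (s + τ) hs' hs'min x
  set o := ∑ t ∈ T, ‖C *ᵥ flow lam t x‖ with ho
  have ho' : ∑ t ∈ T', ‖C *ᵥ flow lam t x‖ ≤ o :=
    Finset.sum_le_sum_of_subset_of_nonneg (Finset.filter_subset _ _) fun _ _ _ => norm_nonneg _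
  have ho0 : 0 ≤ o := Finset.sum_nonneg fun _ _ => norm_nonneg _
  set y := flow lam s x with hy
  have hflow : ∀ i, flow lam (s + τ) x i = lam i ^ τ * y i := fun i => by
    simp only [hy, flow, pow_add]; ring
  set a := ‖part U' y‖
  set b := ‖part I y‖
  set c := ‖part Uᶜ y‖
  have ha0 : 0 ≤ a := norm_nonneg _
  have hb0 : 0 ≤ b := norm_nonneg _
  have hc0 : 0 ≤ c := norm_nonneg _
  have hfast : r' ^ τ * a ≤ ‖part U' (flow lam (s + τ) x)‖ := by
    have : a ≤ ‖part U' (flow lam (s + τ) x)‖ / r' ^ τ := by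
      refine (norm_part_le_iff (by positivity)).2 fun i hi => ?_
      rw [le_div_iff₀ (by positivity)]
      refine le_trans ?_ (norm_le_norm_part _ hi)
      rw [hflow, norm_mul, norm_pow, mul_comm]
      gcongr
      exact hgap i hi
    rwa [le_div_iff₀ (by positivity), mul_comm] at this
  have hslow : ‖part U'ᶜ (flow lam (s + τ) x)‖ ≤ r ^ τ * (b + c) := by
    refine (norm_part_le_iff (by positivity)).2 fun i hi => ?_
    have hi' := Finset.mem_compl.1 hi
    rw [hflow, norm_mul, norm_pow]
    gcongr
    · exact hle i hi'
    · by_cases hiU : i ∈ U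
      · have : i ∈ I := by
          by_contra h
          exact h (Finset.mem_filter.2 ⟨hiU, by
            by_contra h'
            exact hi' (Finset.mem_filter.2 ⟨hiU, h'⟩)⟩)
        linarith [norm_le_norm_part y this]
      · linarith [norm_le_norm_part y (Finset.mem_compl.2 hiU)]
  have hrτ : r ^ τ = r' ^ τ * ρ ^ τ := by
    rw [← mul_pow, hρ, mul_div_cancel₀ _ hr'0.ne']
  have hr'τ : 1 ≤ r' ^ τ := one_le_pow₀ (by linarith)
  have hρD : ρ ^ τ ≤ ρ ^ D := pow_le_pow_of_le_one hρ0 hρ1.le hDτ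
  -- Going back from `s + τ` to `s` divides the fast modes by at least `r' ^ τ`, while the slower
  -- ones had grown by at most `r ^ τ`; the ratio is `ρ ^ τ`.
  have h1 : a ≤ K' * o + K' * ρ ^ D * (b + c) := by
    refine le_of_mul_le_mul_left ?_ (by positivity : 0 < r' ^ τ)
    calc r' ^ τ * a ≤ K' * (o + r' ^ τ * ρ ^ τ * (b + c)) := by
          rw [← hrτ]
          exact hfast.trans (hI'.trans (by gcongr))
      _ = 1 * (K' * o) + r' ^ τ * (K' * ρ ^ τ * (b + c)) := by ring
      _ ≤ r' ^ τ * (K' * o) + r' ^ τ * (K' * ρ ^ D * (b + c)) := by gcongr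
      _ = _ := by ring
  -- The sample at time `s` itself determines block `I` once the other modes are subtracted.
  have h2 : b ≤ L * (o + B * a + B * c) := by
    have hdec : part I y = y - part U' y - part Uᶜ y := by
      ext i
      by_cases hiU : i ∈ U <;> by_cases hir : ‖lam i‖ = r <;> simp [part, hI, hU', hiU, hir]
    refine (hLI y).trans ?_
    gcongr
    rw [hdec, Matrix.mulVec_sub, Matrix.mulVec_sub]
    refine (norm_sub_le _ _).trans (add_le_add ((norm_sub_le _ _).trans (add_le_add ?_ (hCB _)))
      (hCB _))
    exact Finset.single_le_sum (f := fun t => ‖C *ᵥ flow lam t x‖) (fun _ _ => norm_nonneg _) hs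
  have h3 : b ≤ 2 * L * (1 + B * K') * o + (1 + 2 * L * B) * c := by
    have h4 : L * B * a ≤ L * B * (K' * o + K' * ρ ^ D * (b + c)) := by gcongr
    have h5 : L * B * K' * ρ ^ D * (b + c) ≤ 1 / 2 * (b + c) := by gcongr
    linarith
  have h6 : a ≤ K' * o + K' * (b + c) := by
    have : ρ ^ D ≤ 1 := pow_le_one₀ hρ0 hρ1.le
    refine h1.trans ?_
    gcongr
    exact mul_le_of_le_one_right hK' this
  have h7 : ‖part U y‖ ≤ a + b := by
    refine (norm_part_le_iff (by positivity)).2 fun i hi => ?_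
    by_cases hir : ‖lam i‖ = r
    · linarith [norm_le_norm_part y (show i ∈ I from Finset.mem_filter.2 ⟨hi, hir⟩)]
    · linarith [norm_le_norm_part y (show i ∈ U' from Finset.mem_filter.2 ⟨hi, hir⟩)]
  set X := 2 * L * (1 + B * K')
  set Y := 1 + 2 * L * B
  have hX : 0 ≤ X := by positivity
  have hY : 0 ≤ Y := by positivity
  calc ‖part U y‖ ≤ K' * o + K' * c + (K' + 1) * b := by linarith
    _ ≤ K' * o + K' * c + (K' + 1) * (X * o + Y * c) := by gcongr
    _ ≤ (K' + (K' + 1) * (X + Y) + K') * (o + c) := by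
      have e1 : 0 ≤ K' * o := by positivity
      have e2 : 0 ≤ K' * c := by positivity
      have e3 : 0 ≤ (K' + 1) * (X * c) := by positivity
      have e4 : 0 ≤ (K' + 1) * (Y * o) := by positivity
      linarith

/-- The indices of the unstable and critically stable eigenvalues. -/
def unstableSet (lam : Fin n → ℂ) : Finset (Fin n) := Finset.univ.filter fun i => 1 ≤ ‖lam i‖

/-- Boundedly many samples, at arbitrary times, determine the unstable state uniformly. -/
lemma exists_norm_le_sum_samples
    (hobs : ∀ I : Finset (Fin n), IsEquiBlock lam I → (∀ i ∈ I, 1 ≤ ‖lam i‖) →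
      OneStepObservable (blockOutput C I)) :
    ∃ (H : ℕ) (K : ℝ), 0 ≤ K ∧ ∀ T : Finset ℕ, H ≤ T.card → ∀ x,
      (∀ i ∉ unstableSet lam, x i = 0) → ‖x‖ ≤ K * ∑ t ∈ T, ‖C *ᵥ flow lam t x‖ := by
  obtain ⟨H, K, hK, h⟩ := exists_norm_part_le hobs (unstableSet lam)
    (fun i hi => (Finset.mem_filter.1 hi).2) fun i hi j hj => by
      simp only [unstableSet, Finset.mem_filter, Finset.mem_univ, true_and, not_le] at hi hj
      linarith
  refine ⟨H + 1, K, hK, fun T hT x hx => ?_⟩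
  have hne : T.Nonempty := Finset.card_pos.1 (by omega)
  have h1 := h T (by omega) _ (T.min'_mem hne) (fun t ht => T.min'_le t ht) x
  have h2 : ‖part (unstableSet lam)ᶜ (flow lam (T.min' hne) x)‖ = 0 :=
    le_antisymm ((norm_part_le_iff le_rfl).2 fun i hi => by
      simp [flow, hx i (Finset.mem_compl.1 hi)]) (norm_nonneg _)
  rw [h2, add_zero] at h1
  -- Modes of modulus at least 1 do not shrink before the first sample, so the initial state is no
  -- larger than the sampled one.
  refine le_trans ((pi_norm_le_iff_of_nonneg (norm_nonneg _)).2 fun i => ?_) h1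
  by_cases hi : i ∈ unstableSet lam
  · refine le_trans ?_ (norm_le_norm_part _ hi)
    rw [flow, norm_mul, norm_pow]
    exact le_mul_of_one_le_left (norm_nonneg _) (one_le_pow₀ (Finset.mem_filter.1 hi).2)
  · rw [hx i hi]; simp

end Observability

/-! ### Control of the dual system -/

section Control

variable {n m : ℕ}

/-- A lower bound for a family of matrices gives bounded right inverses of the transposes. -/
lemma exists_sum_transpose_mulVec_eq {ι β : Type*} [Fintype β] [DecidableEq β]
    (T : Finset ι) (F : ι → Matrix (Fin m) β ℂ) {K : ℝ} (hK : 0 ≤ K)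
    (hF : ∀ x, ‖x‖ ≤ K * ∑ t ∈ T, ‖F t *ᵥ x‖) (ζ : β → ℂ) :
    ∃ v : ι → Fin m → ℂ, ∑ t ∈ T, (F t)ᵀ *ᵥ v t = ζ ∧
      ∀ t ∈ T, ‖v t‖ ≤ T.card * Fintype.card β * K * ‖ζ‖ := by
  -- The observability Gramian. The lower bound makes it invertible, and solving `G x = star ζ`
  -- gives the inputs `star (F t *ᵥ x)`.
  let G : Matrix β β ℂ := ∑ t ∈ T, (F t)ᴴ * F t
  have hG : ∀ x, star x ⬝ᵥ G *ᵥ x = ∑ t ∈ T, star (F t *ᵥ x) ⬝ᵥ (F t *ᵥ x) := fun x => by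
    simp only [G, Matrix.sum_mulVec, dotProduct_sum, ← Matrix.mulVec_mulVec]
    refine Finset.sum_congr rfl fun t _ => ?_
    rw [Matrix.dotProduct_mulVec, Matrix.star_mulVec]
  have hsq : ∀ w : Fin m → ℂ, ‖w‖ ^ 2 ≤ (star w ⬝ᵥ w).re := fun w => by
    have hw : (star w ⬝ᵥ w).re = ∑ j, ‖w j‖ ^ 2 := by
      simp [dotProduct, ← Complex.normSq_eq_conj_mul_self, Complex.normSq_eq_norm_sq,
        -Complex.ofReal_pow]
    rw [hw]
    have h0 : 0 ≤ ∑ j, ‖w j‖ ^ 2 := Finset.sum_nonneg fun _ _ => sq_nonneg _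
    have : ‖w‖ ≤ Real.sqrt (∑ j, ‖w j‖ ^ 2) :=
      (pi_norm_le_iff_of_nonneg (Real.sqrt_nonneg _)).2 fun j => Real.le_sqrt_of_sq_le
        (Finset.single_le_sum (f := fun j => ‖w j‖ ^ 2) (fun _ _ => sq_nonneg _)
          (Finset.mem_univ j))
    calc ‖w‖ ^ 2 ≤ Real.sqrt (∑ j, ‖w j‖ ^ 2) ^ 2 := by gcongr
      _ = _ := Real.sq_sqrt h0
  have hlow : ∀ x, (∑ t ∈ T, ‖F t *ᵥ x‖) ^ 2 ≤ T.card * (star x ⬝ᵥ G *ᵥ x).re := fun x => by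
    rw [hG, Complex.re_sum]
    refine sq_sum_le_card_mul_sum_sq.trans ?_
    gcongr
    exact hsq _
  have hinj : Function.Injective G.mulVecLin := by
    rw [← LinearMap.ker_eq_bot, LinearMap.ker_eq_bot']
    intro x hx
    have h := hlow x
    rw [show G *ᵥ x = 0 from hx, dotProduct_zero, Complex.zero_re, mul_zero] at h
    have h' := hF x
    rw [pow_eq_zero_iff two_ne_zero |>.1 (le_antisymm h (sq_nonneg _)), mul_zero] at h'
    exact norm_le_zero_iff.1 h'
  obtain ⟨x, hx⟩ := LinearMap.injective_iff_surjective.1 hinj (star ζ)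
  have hx' : G *ᵥ x = star ζ := hx
  refine ⟨fun t => star (F t *ᵥ x), ?_, fun t ht => ?_⟩
  · have h : star (G *ᵥ x) = ζ := by rw [hx', star_star]
    rw [← h]
    simp only [G, Matrix.sum_mulVec, star_sum, ← Matrix.mulVec_mulVec]
    refine Finset.sum_congr rfl fun t _ => ?_
    rw [Matrix.star_mulVec (F t)ᴴ, Matrix.conjTranspose_conjTranspose, Matrix.mulVec_transpose]
  · set σ := ∑ t ∈ T, ‖F t *ᵥ x‖ with hσ
    have hσ0 : 0 ≤ σ := Finset.sum_nonneg fun _ _ => norm_nonneg _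
    have h1 : ‖star (F t *ᵥ x)‖ ≤ σ := by
      rw [norm_star]
      exact Finset.single_le_sum (f := fun t => ‖F t *ᵥ x‖) (fun _ _ => norm_nonneg _) ht
    refine h1.trans ?_
    have h2 : (star x ⬝ᵥ G *ᵥ x).re ≤ Fintype.card β * (‖x‖ * ‖ζ‖) := by
      rw [hx']
      refine (Complex.re_le_norm _).trans ((norm_sum_le _ _).trans ?_)
      rw [← nsmul_eq_mul, ← Finset.card_univ]
      refine Finset.sum_le_card_nsmul _ _ _ fun i _ => ?_
      rw [norm_mul, Pi.star_apply, Pi.star_apply, norm_star, norm_star]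
      gcongr <;> exact norm_le_pi_norm _ i
    rcases hσ0.eq_or_lt with h0 | h0
    · rw [← h0]; positivity
    · refine le_of_mul_le_mul_right ?_ h0
      -- The energy `x* G x` pairs `x` with `ζ` and `‖x‖ ≤ K σ`, so `σ²` is bounded linearly in `σ`
      -- and one factor cancels.
      calc σ * σ = σ ^ 2 := by ring
        _ ≤ T.card * (Fintype.card β * (K * σ * ‖ζ‖)) := by
          refine (hlow x).trans ?_
          gcongr
          refine h2.trans ?_
          gcongr
          exact hF x
        _ = _ := by ring

lemma scalar_recursion_eq {lam : ℂ} {x b : ℕ → ℂ} (h : ∀ i, x (i + 1) = lam * x i - b i) (s : ℕ) :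
    x s = lam ^ s * x 0 - ∑ t ∈ Finset.range s, lam ^ t * b (s - 1 - t) := by
  induction s with
  | zero => simp
  | succ s ih =>
    rw [h, ih, Finset.sum_range_succ', mul_sub, Finset.mul_sum]
    have : ∑ t ∈ Finset.range s, lam * (lam ^ t * b (s - 1 - t)) =
        ∑ t ∈ Finset.range s, lam ^ (t + 1) * b (s + 1 - 1 - (t + 1)) :=
      Finset.sum_congr rfl fun t _ => by
        rw [show s + 1 - 1 - (t + 1) = s - 1 - t by omega]; ring
    rw [this]
    simp only [pow_zero, one_mul, Nat.add_sub_cancel, Nat.sub_zero]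
    ring

/-- For an unstable mode the recursion is solved backward from its zero terminal value, where
division by `lam` does not expand; the bound thus involves no power of `lam`. -/
lemma scalar_recursion_norm_le_of_one_le {lam : ℂ} {x b : ℕ → ℂ}
    (h : ∀ i, x (i + 1) = lam * x i - b i) (hlam : 1 ≤ ‖lam‖) {s : ℕ} (hs : x s = 0)
    (hb : ∀ i, s ≤ i → b i = 0) (i : ℕ) :
    (i ≤ s → ‖x i‖ ≤ ∑ l ∈ Finset.range s, ‖b l‖) ∧ (s ≤ i → x i = 0) := by
  constructor
  · intro hi
    have key : ‖x i‖ ≤ ∑ l ∈ Finset.Ico i s, ‖b l‖ := by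
      induction hi using Nat.decreasingInduction with
      | self => simp [hs]
      | of_succ i hi ih =>
        rw [Finset.sum_eq_sum_Ico_succ_bot hi]
        have h1 : lam * x i = b i + x (i + 1) := by rw [h]; ring
        calc ‖x i‖ ≤ ‖lam‖ * ‖x i‖ := le_mul_of_one_le_left (norm_nonneg _) hlam
          _ = ‖b i + x (i + 1)‖ := by rw [← norm_mul, h1]
          _ ≤ _ := (norm_add_le _ _).trans (by gcongr)
    refine key.trans (Finset.sum_le_sum_of_subset_of_nonneg (fun l hl => ?_)
      fun _ _ _ => norm_nonneg _)
    exact Finset.mem_range.2 (Finset.mem_Ico.1 hl).2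
  · intro hi
    induction i, hi using Nat.le_induction with
    | base => exact hs
    | succ i hi ih => rw [h, ih, hb i hi]; simp

/-- A stable mode only accumulates the inputs up to time `s` and decays freely afterwards; truncated
subtraction makes the decay factor 1 before `s`. -/
lemma scalar_recursion_norm_le_of_lt_one {lam : ℂ} {x b : ℕ → ℂ}
    (h : ∀ i, x (i + 1) = lam * x i - b i) {ρ : ℝ} (hlam : ‖lam‖ ≤ ρ) (hρ : ρ ≤ 1) {s : ℕ}
    (hb : ∀ i, s ≤ i → b i = 0) (i : ℕ) :
    ‖x i‖ ≤ (‖x 0‖ + ∑ l ∈ Finset.range s, ‖b l‖) * ρ ^ (i - s) := by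
  have key : ∀ i, i ≤ s → ‖x i‖ ≤ ‖x 0‖ + ∑ l ∈ Finset.range i, ‖b l‖ := fun i => by
    induction i with
    | zero => simp
    | succ i ih =>
      intro hi
      rw [h, Finset.sum_range_succ, ← add_assoc]
      refine (norm_sub_le _ _).trans (add_le_add ?_ le_rfl)
      rw [norm_mul]
      exact (mul_le_of_le_one_left (norm_nonneg _) (hlam.trans hρ)).trans (ih (by omega))
  have hρ0 : 0 ≤ ρ := (norm_nonneg _).trans hlam
  rcases le_total i s with hi | hi
  · rw [Nat.sub_eq_zero_of_le hi, pow_zero, mul_one]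
    refine (key i hi).trans ?_
    gcongr
  · induction i, hi using Nat.le_induction with
    | base => simpa using key s le_rfl
    | succ i hi ih =>
      rw [h, hb i hi, sub_zero, norm_mul, Nat.succ_sub hi, pow_succ, ← mul_assoc, mul_comm]
      gcongr

variable {C : Matrix (Fin m) (Fin n) ℂ} {lam : Fin n → ℂ}

lemma exists_norm_le_of_notMem_unstableSet (lam : Fin n → ℂ) :
    ∃ ρ : ℝ, 0 ≤ ρ ∧ ρ < 1 ∧ ∀ i ∉ unstableSet lam, ‖lam i‖ ≤ ρ := by
  rcases (unstableSet lam)ᶜ.eq_empty_or_nonempty with h | h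
  · exact ⟨0, le_rfl, one_pos, fun i hi => absurd (Finset.mem_compl.2 hi) (by simp [h])⟩
  · obtain ⟨i, hi, hmax⟩ := (unstableSet lam)ᶜ.exists_max_image (fun i => ‖lam i‖) h
    refine ⟨‖lam i‖, norm_nonneg _, ?_, fun j hj => hmax j (Finset.mem_compl.2 hj)⟩
    simpa [unstableSet] using hi

/-- Open-loop evolution with boundedly many corrections: the unstable part is steered to zero. -/
lemma exists_dual_control
    (hobs : ∀ I : Finset (Fin n), IsEquiBlock lam I → (∀ i ∈ I, 1 ≤ ‖lam i‖) →
      OneStepObservable (blockOutput C I))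
    {κ : ℝ} (hκ : 1 ≤ κ) (hlam : ∀ i, ‖lam i‖ ≤ κ) :
    ∃ (H : ℕ) (K ρ : ℝ), 0 ≤ K ∧ 0 ≤ ρ ∧ ρ < 1 ∧ ∀ (h : ℕ → ℝ) (s : ℕ),
      H ≤ ((Finset.range s).filter fun t => h (s - 1 - t) = 1).card → ∀ ζ₀ : Fin n → ℂ,
      ∃ (ζ : ℕ → Fin n → ℂ) (u : ℕ → Fin m → ℂ), ζ 0 = ζ₀ ∧
        (∀ i, ζ (i + 1) = Matrix.diagonal lam *ᵥ ζ i - (h i : ℂ) • Cᵀ *ᵥ u i) ∧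
        (∀ i, ‖ζ i‖ ≤ K * κ ^ s * ‖ζ₀‖ * ρ ^ (i - s)) ∧
        (∀ i, ‖u i‖ ≤ K * κ ^ s * ‖ζ₀‖) ∧ ∀ i, s ≤ i → u i = 0 := by
  obtain ⟨H, K, hK, hsamples⟩ := exists_norm_le_sum_samples hobs
  obtain ⟨ρ, hρ0, hρ1, hρ⟩ := exists_norm_le_of_notMem_unstableSet lam
  obtain ⟨B, hB, hCB⟩ := exists_norm_mulVec_le Cᵀ
  set U := unstableSet lam
  let K₁ : ℝ := H * Fintype.card U * K
  have hK₁ : 0 ≤ K₁ := by positivity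
  refine ⟨H, K₁ + (1 + H * (B * K₁)), ρ, by positivity, hρ0, hρ1, fun h s hcard ζ₀ => ?_⟩
  -- Exactly `H` arrivals are used, which keeps the constants independent of their total number.
  obtain ⟨T, hTs, hTc⟩ := Finset.exists_subset_card_eq hcard
  have hT : ∀ t ∈ T, t < s ∧ h (s - 1 - t) = 1 := fun t ht => by
    simpa using Finset.mem_filter.1 (hTs ht)
  let F : ℕ → Matrix (Fin m) U ℂ := fun t => Matrix.of fun j i => lam i ^ t * C j i
  have hF : ∀ x, ‖x‖ ≤ K * ∑ t ∈ T, ‖F t *ᵥ x‖ := fun x => by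
    let y : Fin n → ℂ := fun i => if hi : i ∈ U then x ⟨i, hi⟩ else 0
    have h1 := hsamples T hTc.ge y fun i hi => by simp only [y, dif_neg hi]
    have h2 : ‖x‖ ≤ ‖y‖ := (pi_norm_le_iff_of_nonneg (norm_nonneg _)).2 fun i => by
      have := norm_le_pi_norm y i
      simpa only [y, dif_pos i.2] using this
    have h3 : ∀ t, C *ᵥ flow lam t y = F t *ᵥ x := fun t => by
      ext j
      simp only [Matrix.mulVec, dotProduct, flow, F, Matrix.of_apply]
      rw [← Finset.sum_subset (Finset.subset_univ U) fun i _ hi => by simp only [y, dif_neg hi]; simp,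
        ← Finset.sum_coe_sort]
      refine Finset.sum_congr rfl fun i _ => ?_
      simp only [y, dif_pos i.2]
      ring
    simp only [h3] at h1
    exact h2.trans h1
  have hκs : 1 ≤ κ ^ s := one_le_pow₀ hκ
  -- The target is the uncontrolled unstable state at time `s`, to be cancelled by the corrections.
  obtain ⟨v, hv, hvn⟩ := exists_sum_transpose_mulVec_eq T F hK hF fun i => lam i ^ s * ζ₀ i
  have hvn' : ∀ t ∈ T, ‖v t‖ ≤ K₁ * (κ ^ s * ‖ζ₀‖) := fun t ht => by
    refine (hvn t ht).trans ?_
    rw [hTc]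
    refine mul_le_mul_of_nonneg_left ?_ hK₁
    refine (pi_norm_le_iff_of_nonneg (by positivity)).2 fun i => ?_
    rw [norm_mul, norm_pow]
    gcongr
    · exact hlam i
    · exact norm_le_pi_norm ζ₀ i
  -- A correction indexed by `t` acts at time `s - 1 - t` and is multiplied by `lam ^ t` until time
  -- `s`. The guard `i < s` is needed because the subtraction truncates.
  let u : ℕ → Fin m → ℂ := fun i => if i < s ∧ s - 1 - i ∈ T then v (s - 1 - i) else 0
  let b : ℕ → Fin n → ℂ := fun i => (h i : ℂ) • Cᵀ *ᵥ u i
  let ζ : ℕ → Fin n → ℂ := fun i => Nat.rec ζ₀ (fun i z => Matrix.diagonal lam *ᵥ z - b i) i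
  have hζ : ∀ i, ζ (i + 1) = Matrix.diagonal lam *ᵥ ζ i - b i := fun i => rfl
  have hζj : ∀ j i, ζ (i + 1) j = lam j * ζ i j - b i j := fun j i => by
    rw [hζ, Pi.sub_apply, Matrix.mulVec_diagonal]
  have hu0 : ∀ i, s ≤ i → u i = 0 := fun i hi => if_neg (by omega)
  have hb0 : ∀ i, s ≤ i → b i = 0 := fun i hi => by simp [b, hu0 i hi]
  have hbt : ∀ t < s, b (s - 1 - t) = if t ∈ T then Cᵀ *ᵥ v t else 0 := fun t ht => by
    have e : s - 1 - (s - 1 - t) = t := by omega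
    have e' : s - 1 - t < s := by omega
    by_cases htT : t ∈ T
    · simp [b, u, e, e', htT, (hT t htT).2]
    · simp [b, u, e, htT]
  have hun : ∀ i, ‖u i‖ ≤ K₁ * (κ ^ s * ‖ζ₀‖) := fun i => by
    by_cases hi : i < s ∧ s - 1 - i ∈ T
    · simp only [u, if_pos hi]
      exact hvn' _ hi.2
    · simp only [u, if_neg hi, norm_zero]
      positivity
  have hTrange : T ⊆ Finset.range s := hTs.trans (Finset.filter_subset _ _)
  have hbsum : ∀ j, ∑ l ∈ Finset.range s, ‖b l j‖ ≤ H * (B * (K₁ * (κ ^ s * ‖ζ₀‖))) := fun j => by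
    rw [← Finset.sum_range_reflect, ← hTc, ← nsmul_eq_mul,
      ← Finset.sum_subset hTrange fun t ht htT => by
        rw [hbt t (Finset.mem_range.1 ht), if_neg htT]; simp]
    refine Finset.sum_le_card_nsmul _ _ _ fun t ht => ?_
    rw [hbt t (hT t ht).1, if_pos ht]
    refine (norm_le_pi_norm (Cᵀ *ᵥ v t) j).trans ((hCB _).trans ?_)
    gcongr
    exact hvn' t ht
  refine ⟨ζ, u, rfl, hζ, fun i => ?_, fun i => (hun i).trans ?_, hu0⟩
  · have hmain : (1 + H * (B * K₁)) * κ ^ s * ‖ζ₀‖ * ρ ^ (i - s) ≤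
        (K₁ + (1 + H * (B * K₁))) * κ ^ s * ‖ζ₀‖ * ρ ^ (i - s) := by
      gcongr ?_ * _ * _ * _
      linarith
    refine (pi_norm_le_iff_of_nonneg (by positivity)).2 fun j => le_trans ?_ hmain
    by_cases hj : j ∈ U
    · have hzero : ζ s j = 0 := by
        rw [scalar_recursion_eq (x := fun i => ζ i j) (b := fun i => b i j) (hζj j) s]
        have h1 : ∑ t ∈ Finset.range s, lam j ^ t * b (s - 1 - t) j =
            ∑ t ∈ T, lam j ^ t * (Cᵀ *ᵥ v t) j := by
          rw [← Finset.sum_subset hTrange fun t ht htT => by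
            rw [hbt t (Finset.mem_range.1 ht), if_neg htT]; simp]
          exact Finset.sum_congr rfl fun t ht => by rw [hbt t (hT t ht).1, if_pos ht]
        have h2 := congrFun hv ⟨j, hj⟩
        rw [Finset.sum_apply] at h2
        rw [h1, sub_eq_zero]
        refine h2.symm.trans (Finset.sum_congr rfl fun t _ => ?_)
        simp only [Matrix.mulVec, dotProduct, Matrix.transpose_apply, F, Matrix.of_apply,
          Finset.mul_sum, mul_assoc]
      obtain ⟨h1, h2⟩ := scalar_recursion_norm_le_of_one_le (x := fun i => ζ i j)
        (b := fun i => b i j) (hζj j) (Finset.mem_filter.1 hj).2 hzero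
        (fun i hi => by simp [hb0 i hi]) i
      rcases le_total i s with hi | hi
      · rw [Nat.sub_eq_zero_of_le hi, pow_zero, mul_one]
        refine ((h1 hi).trans (hbsum j)).trans ?_
        have : 0 ≤ κ ^ s * ‖ζ₀‖ := by positivity
        linarith
      · rw [show ζ i j = 0 from h2 hi, norm_zero]
        positivity
    · refine (scalar_recursion_norm_le_of_lt_one (x := fun i => ζ i j)
        (b := fun i => b i j) (s := s) (hζj j) (hρ j hj) hρ1.le (fun i hi => by simp [hb0 i hi]) i).trans ?_
      gcongr
      have h1 : ‖ζ₀ j‖ ≤ κ ^ s * ‖ζ₀‖ :=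
        (norm_le_pi_norm ζ₀ j).trans (le_mul_of_one_le_left (norm_nonneg _) hκs)
      calc ‖ζ 0 j‖ + ∑ l ∈ Finset.range s, ‖b l j‖
          ≤ κ ^ s * ‖ζ₀‖ + H * (B * (K₁ * (κ ^ s * ‖ζ₀‖))) := add_le_add h1 (hbsum j)
        _ = _ := by ring
  · have : 0 ≤ (1 + H * (B * K₁)) * (κ ^ s * ‖ζ₀‖) := by positivity
    linarith

end Control

/-! ### Pathwise bounds -/

section Pathwise

variable {n m : ℕ}

/-- The entrywise real part. -/
def reVec {k : ℕ} (v : Fin k → ℂ) : Fin k → ℝ := fun i => (v i).re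

lemma norm_reVec_le {k : ℕ} (v : Fin k → ℂ) : ‖reVec v‖ ≤ ‖v‖ :=
  (pi_norm_le_iff_of_nonneg (norm_nonneg _)).2 fun i =>
    (Complex.abs_re_le_norm _).trans (norm_le_pi_norm v i)

lemma reVec_sub {k : ℕ} (v w : Fin k → ℂ) : reVec (v - w) = reVec v - reVec w := rfl

lemma reVec_smul {k : ℕ} (c : ℝ) (v : Fin k → ℂ) : reVec ((c : ℂ) • v) = c • reVec v := by
  ext i; simp [reVec]

lemma reVec_transpose_mulVec {k l : ℕ} (M : Matrix (Fin k) (Fin l) ℝ) (v : Fin k → ℂ) :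
    reVec ((toC M)ᵀ *ᵥ v) = Mᵀ *ᵥ reVec v := by
  ext i
  simp [reVec, toC, Matrix.mulVec, dotProduct]

variable {A : Matrix (Fin n) (Fin n) ℝ} {C : Matrix (Fin m) (Fin n) ℝ}
  {Q : Matrix (Fin n) (Fin n) ℝ} {R : Matrix (Fin m) (Fin m) ℝ} {P₀ : Matrix (Fin n) (Fin n) ℝ}
  {S : Matrix (Fin n) (Fin n) ℂ} {lam : Fin n → ℂ}

lemma IsDiagonalization.mul_eq (h : IsDiagonalization A S lam) :
    toC A * S = S * Matrix.diagonal lam := by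
  rw [← h.2, ← Matrix.mul_assoc, ← Matrix.mul_assoc,
    Matrix.mul_nonsing_inv _ ((Matrix.isUnit_iff_isUnit_det _).1 h.1), Matrix.one_mul]

/-- The error covariance is dominated by the cost of any control of the dual system, written in
eigencoordinates and in reversed time. -/
lemma IsDiagonalization.exists_quadForm_errorCov_le (h : IsDiagonalization A S lam)
    (hP₀ : P₀.PosSemidef) (hQ : Q.PosSemidef) (hR : R.PosDef) :
    ∃ K : ℝ, 0 ≤ K ∧ ∀ (g : ℕ → ℝ), (∀ t, g t = 0 ∨ g t = 1) → ∀ (k : ℕ) (z : Fin n → ℝ)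
      (ζ : ℕ → Fin n → ℂ) (u : ℕ → Fin m → ℂ), ζ 0 = Sᵀ *ᵥ (fun i => (z i : ℂ)) →
      (∀ i, ζ (i + 1) = Matrix.diagonal lam *ᵥ ζ i -
        (g (k - 1 - i) : ℂ) • (toC C * S)ᵀ *ᵥ u i) →
      quadForm (errorCov A C Q R P₀ g k) z ≤
        K * (‖ζ k‖ ^ 2 + ∑ i ∈ Finset.range k, (‖ζ i‖ ^ 2 + ‖u i‖ ^ 2)) := by
  obtain ⟨KP, hKP, hP⟩ := quadForm_le_sq_norm P₀
  obtain ⟨KQ, hKQ, hQ'⟩ := quadForm_le_sq_norm Q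
  obtain ⟨KR, hKR, hR'⟩ := quadForm_le_sq_norm R
  obtain ⟨B, hB, hW⟩ := exists_norm_mulVec_le (Sᵀ)⁻¹
  have hdet : IsUnit (Sᵀ).det := by
    rw [Matrix.det_transpose]
    exact (Matrix.isUnit_iff_isUnit_det _).1 h.1
  have hWS : (Sᵀ)⁻¹ * Sᵀ = 1 := Matrix.nonsing_inv_mul _ hdet
  have hSW : Sᵀ * (Sᵀ)⁻¹ = 1 := Matrix.mul_nonsing_inv _ hdet
  set W := (Sᵀ)⁻¹
  have hWA : W * Matrix.diagonal lam = (toC A)ᵀ * W := by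
    have h1 := congrArg Matrix.transpose h.mul_eq
    rw [Matrix.transpose_mul, Matrix.transpose_mul, Matrix.diagonal_transpose] at h1
    calc W * Matrix.diagonal lam = W * (Matrix.diagonal lam * Sᵀ) * W := by
          rw [Matrix.mul_assoc, Matrix.mul_assoc, hSW, Matrix.mul_one]
      _ = (toC A)ᵀ * W := by rw [← h1, ← Matrix.mul_assoc W, hWS, Matrix.one_mul]
  refine ⟨KP * B ^ 2 + KQ * B ^ 2 + KR, by positivity, fun g hg k z ζ u h0 hrec => ?_⟩
  -- Since `A`, `C` and the arrivals are real, the real part of a complex trajectory, taken back to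
  -- the original coordinates, is again an admissible trajectory.
  set Z : ℕ → Fin n → ℝ := fun i => reVec (W *ᵥ ζ i) with hZ
  have hZn : ∀ i, ‖Z i‖ ^ 2 ≤ B ^ 2 * ‖ζ i‖ ^ 2 := fun i => by
    rw [← mul_pow]
    gcongr
    exact (norm_reVec_le _).trans (hW _)
  have hZ0 : Z 0 = z := by
    simp only [hZ, h0, Matrix.mulVec_mulVec, hWS, Matrix.one_mulVec]
    rfl
  have hZrec : ∀ i, Z (i + 1) = Aᵀ *ᵥ Z i - g (k - 1 - i) • Cᵀ *ᵥ reVec (u i) := fun i => by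
    simp only [hZ]
    rw [hrec, Matrix.mulVec_sub, Matrix.mulVec_smul, Matrix.mulVec_mulVec, hWA,
      Matrix.transpose_mul, ← Matrix.mulVec_mulVec, ← Matrix.mulVec_mulVec, Matrix.mulVec_mulVec _ W Sᵀ,
      hWS, Matrix.one_mulVec, reVec_sub, reVec_smul, reVec_transpose_mulVec,
      reVec_transpose_mulVec]
  have hmain := quadForm_errorCov_le (A := A) (C := C) hP₀ hQ hR hg k (fun t => Z (k - t))
    (fun t => reVec (u (k - 1 - t))) fun t ht => by
      have := hZrec (k - 1 - t)
      rw [show k - 1 - (k - 1 - t) = t by omega, show k - 1 - t + 1 = k - t by omega] at this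
      rw [this, show k - 1 - t = k - (t + 1) by omega]
  simp only [Nat.sub_self, Nat.sub_zero, hZ0] at hmain
  refine hmain.trans ?_
  rw [← Finset.sum_range_reflect, mul_add]
  refine add_le_add ?_ ?_
  · have h1 : quadForm P₀ (Z k) ≤ KP * B ^ 2 * ‖ζ k‖ ^ 2 := by
      refine (hP _).trans ?_
      rw [mul_assoc]
      gcongr
      exact hZn k
    refine h1.trans ?_
    gcongr
    have : 0 ≤ KQ * B ^ 2 := by positivity
    linarith
  · rw [Finset.mul_sum]
    refine Finset.sum_le_sum fun i hi => ?_
    have hi' := Finset.mem_range.1 hi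
    rw [show k - (k - 1 - i + 1) = i by omega, show k - 1 - (k - 1 - i) = i by omega]
    have h1 : quadForm Q (Z i) ≤ KQ * B ^ 2 * ‖ζ i‖ ^ 2 := by
      refine (hQ' _).trans ?_
      rw [mul_assoc]
      gcongr
      exact hZn i
    have h2 : g (k - 1 - i) * quadForm R (reVec (u i)) ≤ KR * ‖u i‖ ^ 2 := by
      have h3 : quadForm R (reVec (u i)) ≤ KR * ‖u i‖ ^ 2 := by
        refine (hR' _).trans ?_
        gcongr
        exact norm_reVec_le _
      rcases hg (k - 1 - i) with hgi | hgi <;> rw [hgi]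
      · rw [zero_mul]; positivity
      · rwa [one_mul]
    have h4 : 0 ≤ (KP * B ^ 2 + KR) * ‖ζ i‖ ^ 2 := by positivity
    have h5 : 0 ≤ (KP * B ^ 2 + KQ * B ^ 2) * ‖u i‖ ^ 2 := by positivity
    linarith

lemma sum_pow_sub_le {ρ : ℝ} (h0 : 0 ≤ ρ) (h1 : ρ < 1) {s k : ℕ} (hs : s ≤ k) :
    ∑ i ∈ Finset.range k, ρ ^ (i - s) ≤ s + (1 - ρ)⁻¹ := by
  obtain ⟨j, rfl⟩ := Nat.exists_eq_add_of_le hs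
  rw [Finset.sum_range_add]
  refine add_le_add ?_ ?_
  · refine (Finset.sum_le_card_nsmul _ _ 1 fun i hi => ?_).trans (by simp)
    exact pow_le_one₀ h0 h1.le
  · simp only [Nat.add_sub_cancel_left]
    rw [← tsum_geometric_of_lt_one h0 h1]
    exact (summable_geometric_of_lt_one h0 h1).sum_le_tsum _ fun i _ => pow_nonneg h0 i

/-- The error covariance grows at most like `(s + 1) κ ^ (2 s)` in the length `s` of the shortest
past with sufficiently many arrivals. -/
lemma IsDiagonalization.exists_quadForm_errorCov_le_pow (h : IsDiagonalization A S lam)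
    (hP₀ : P₀.PosSemidef) (hQ : Q.PosSemidef) (hR : R.PosDef)
    (hobs : ∀ I : Finset (Fin n), IsEquiBlock lam I → (∀ i ∈ I, 1 ≤ ‖lam i‖) →
      OneStepObservable (blockOutput (toC C * S) I))
    {κ : ℝ} (hκ : 1 ≤ κ) (hlam : ∀ i, ‖lam i‖ ≤ κ) :
    ∃ (H : ℕ) (K : ℝ), 0 ≤ K ∧ ∀ (g : ℕ → ℝ), (∀ t, g t = 0 ∨ g t = 1) → ∀ k s, s ≤ k →
      (s = k ∨ H ≤ ((Finset.range s).filter fun t => g (k - s + t) = 1).card) →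
      ∀ z : Fin n → ℝ,
        quadForm (errorCov A C Q R P₀ g k) z ≤ K * ((s + 1) * (κ ^ s) ^ 2) * ‖z‖ ^ 2 := by
  obtain ⟨K₁, hK₁, hcost⟩ := h.exists_quadForm_errorCov_le (C := C) hP₀ hQ hR
  obtain ⟨H, K₂, ρ, hK₂, hρ0, hρ1, hctrl⟩ := exists_dual_control hobs hκ hlam
  obtain ⟨B, hB, hSB⟩ := exists_norm_mulVec_le Sᵀ
  have hB' : ∀ z : Fin n → ℝ, ‖Sᵀ *ᵥ (fun i => (z i : ℂ))‖ ≤ B * ‖z‖ := fun z => by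
    refine (hSB _).trans ?_
    gcongr
    refine (pi_norm_le_iff_of_nonneg (norm_nonneg _)).2 fun i => ?_
    rw [Complex.norm_real]
    exact norm_le_pi_norm z i
  have hρ' : 0 < 1 - ρ := by linarith
  refine ⟨H, K₁ * (B ^ 2 + (K₂ * B) ^ 2 * (2 + (1 - ρ)⁻¹)), by positivity,
    fun g hg k s hs hcase z => ?_⟩
  set ζ₀ : Fin n → ℂ := Sᵀ *ᵥ (fun i => (z i : ℂ)) with hζ₀
  have hζ₀n := hB' z
  have hκs : 1 ≤ κ ^ s := one_le_pow₀ hκ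
  rcases hcase with rfl | hcount
  -- If `s` is the whole past, the zero control suffices: open-loop growth is at most `κ ^ s`.
  · have hle := hcost g hg s z (fun i => flow lam i ζ₀) 0 (by ext; simp [flow, hζ₀]) fun i => by
      ext j
      simp [flow, Matrix.mulVec_diagonal, pow_succ]; ring
    have hflow : ∀ i ≤ s, ‖flow lam i ζ₀‖ ^ 2 ≤ (κ ^ s) ^ 2 * B ^ 2 * ‖z‖ ^ 2 := fun i hi => by
      rw [← mul_pow, ← mul_pow]
      gcongr
      rw [mul_assoc]
      refine (pi_norm_le_iff_of_nonneg (by positivity)).2 fun j => ?_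
      rw [flow, norm_mul, norm_pow]
      gcongr
      · exact (pow_le_pow_left₀ (norm_nonneg _) (hlam j) i).trans (pow_le_pow_right₀ hκ hi)
      · exact (norm_le_pi_norm ζ₀ j).trans hζ₀n
    refine hle.trans ?_
    have hsum : ∑ i ∈ Finset.range s, (‖flow lam i ζ₀‖ ^ 2 + ‖(0 : ℕ → Fin m → ℂ) i‖ ^ 2) ≤
        s * ((κ ^ s) ^ 2 * B ^ 2 * ‖z‖ ^ 2) := by
      refine (Finset.sum_le_card_nsmul _ _ ((κ ^ s) ^ 2 * B ^ 2 * ‖z‖ ^ 2) fun i hi => ?_).trans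
        (by simp)
      simpa using hflow i (Finset.mem_range.1 hi).le
    calc K₁ * (‖flow lam s ζ₀‖ ^ 2 + _)
        ≤ K₁ * ((κ ^ s) ^ 2 * B ^ 2 * ‖z‖ ^ 2 + s * ((κ ^ s) ^ 2 * B ^ 2 * ‖z‖ ^ 2)) := by
          gcongr
          exact hflow s le_rfl
      _ = K₁ * (B ^ 2 + 0) * ((s + 1) * (κ ^ s) ^ 2) * ‖z‖ ^ 2 := by ring
      _ ≤ _ := by gcongr; positivity
  · obtain ⟨ζ, u, hζ0, hrec, hζn, hun, hu0⟩ := hctrl (fun i => g (k - 1 - i)) s (by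
      refine hcount.trans (le_of_eq (congrArg _ (Finset.filter_congr fun t ht => ?_)))
      have := Finset.mem_range.1 ht
      rw [show k - 1 - (s - 1 - t) = k - s + t by omega]) ζ₀
    refine (hcost g hg k z ζ u hζ0 hrec).trans ?_
    set M := K₂ * κ ^ s * ‖ζ₀‖ with hM
    have hM0 : 0 ≤ M := by positivity
    have hMle : M ^ 2 ≤ (K₂ * B) ^ 2 * (κ ^ s) ^ 2 * ‖z‖ ^ 2 := by
      rw [← mul_pow, ← mul_pow]
      gcongr
      calc M ≤ K₂ * κ ^ s * (B * ‖z‖) := by rw [hM]; gcongr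
        _ = _ := by ring
    have hζn' : ∀ i, ‖ζ i‖ ^ 2 ≤ M ^ 2 * ρ ^ (i - s) := fun i => by
      have hp0 : 0 ≤ ρ ^ (i - s) := pow_nonneg hρ0 _
      have hp1 : ρ ^ (i - s) ≤ 1 := pow_le_one₀ hρ0 hρ1.le
      calc ‖ζ i‖ ^ 2 ≤ (M * ρ ^ (i - s)) ^ 2 := by gcongr; exact hζn i
        _ = M ^ 2 * (ρ ^ (i - s) * ρ ^ (i - s)) := by ring
        _ ≤ M ^ 2 * (ρ ^ (i - s) * 1) := by gcongr
        _ = _ := by ring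
    have hsumζ : ∑ i ∈ Finset.range k, ‖ζ i‖ ^ 2 ≤ M ^ 2 * (s + (1 - ρ)⁻¹) := by
      refine (Finset.sum_le_sum fun i _ => hζn' i).trans ?_
      rw [← Finset.mul_sum]
      gcongr
      exact sum_pow_sub_le hρ0 hρ1 hs
    have hsumu : ∑ i ∈ Finset.range k, ‖u i‖ ^ 2 ≤ s * M ^ 2 := by
      rw [← Finset.sum_subset (Finset.range_mono hs) fun i _ hi => by
        rw [hu0 i (by simpa using hi)]; simp]
      refine (Finset.sum_le_card_nsmul _ _ (M ^ 2) fun i _ => ?_).trans (by simp)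
      gcongr
      exact hun i
    have hlast : ‖ζ k‖ ^ 2 ≤ M ^ 2 :=
      (hζn' k).trans (mul_le_of_le_one_right (sq_nonneg _) (pow_le_one₀ hρ0 hρ1.le))
    have hinv : 0 ≤ (1 - ρ)⁻¹ := by positivity
    rw [Finset.sum_add_distrib]
    calc K₁ * (‖ζ k‖ ^ 2 + (∑ i ∈ Finset.range k, ‖ζ i‖ ^ 2 + ∑ i ∈ Finset.range k, ‖u i‖ ^ 2))
        ≤ K₁ * (M ^ 2 + (M ^ 2 * (s + (1 - ρ)⁻¹) + s * M ^ 2)) := by gcongr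
      _ = K₁ * (M ^ 2 * (1 + 2 * s + (1 - ρ)⁻¹)) := by ring
      _ ≤ K₁ * (M ^ 2 * ((2 + (1 - ρ)⁻¹) * (s + 1))) := by
          gcongr
          have : 0 ≤ (1 - ρ)⁻¹ * s := by positivity
          linarith
      _ ≤ K₁ * ((K₂ * B) ^ 2 * (κ ^ s) ^ 2 * ‖z‖ ^ 2 * ((2 + (1 - ρ)⁻¹) * (s + 1))) := by gcongr
      _ = K₁ * (0 + (K₂ * B) ^ 2 * (2 + (1 - ρ)⁻¹)) * ((s + 1) * (κ ^ s) ^ 2) * ‖z‖ ^ 2 := by ring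
      _ ≤ _ := by gcongr; positivity

end Pathwise

/-! ### The critical value -/

section Critical

variable {n m : ℕ} {A : Matrix (Fin n) (Fin n) ℝ} {C : Matrix (Fin m) (Fin n) ℝ}
  {Q : Matrix (Fin n) (Fin n) ℝ} {R : Matrix (Fin m) (Fin m) ℝ} {P₀ : Matrix (Fin n) (Fin n) ℝ}
  {S : Matrix (Fin n) (Fin n) ℂ} {lam : Fin n → ℂ}

/-- Writing the power as a product over times lets independence factor its expectation. -/
lemma pow_card_arrivals {ε : ℝ} {g : ℕ → ℝ} (hg : ∀ t, g t = 0 ∨ g t = 1) {k s : ℕ} (hs : s ≤ k) :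
    ε ^ ((Finset.range s).filter fun t => g (k - s + t) = 1).card =
      ∏ t ∈ Finset.Ico (k - s) k, (1 - (1 - ε) * g t) := by
  rw [Finset.prod_Ico_eq_prod_range, Nat.sub_sub_self hs, Finset.card_filter,
    ← Finset.prod_pow_eq_pow_sum]
  refine Finset.prod_congr rfl fun t _ => ?_
  rcases hg (k - s + t) with h | h <;> simp [h]

/-- Above the critical value the mean error covariance is bounded. -/
lemma IsDiagonalization.meanBounded.{u} (h : IsDiagonalization A S lam)
    (hP₀ : P₀.PosSemidef) (hQ : Q.PosSemidef) (hR : R.PosDef)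
    (hobs : ∀ I : Finset (Fin n), IsEquiBlock lam I → (∀ i ∈ I, 1 ≤ ‖lam i‖) →
      OneStepObservable (blockOutput (toC C * S) I))
    {κ : ℝ} (hκ : 1 ≤ κ) (hlam : ∀ i, ‖lam i‖ ≤ κ) {p : ℝ} (hp0 : 0 ≤ p) (hp1 : p ≤ 1)
    (hp : (1 - p) * κ ^ 2 < 1) : MeanBounded.{u} A C Q R P₀ p := by
  intro Ω _ μ _ γ hγ
  obtain ⟨H, K, hK, hpath⟩ := h.exists_quadForm_errorCov_le_pow (C := C) hP₀ hQ hR hobs hκ hlam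
  have hκ0 : 0 < κ := by linarith
  -- The Chernoff parameter: at `ε = 0` the inequality is the hypothesis, and by continuity it
  -- persists for small positive `ε`.
  obtain ⟨ε, hε0, hε1, hq⟩ : ∃ ε : ℝ, 0 < ε ∧ ε ≤ 1 ∧ (1 - (1 - ε) * p) * κ ^ 2 < 1 := by
    have hcont : Filter.Tendsto (fun ε : ℝ => (1 - (1 - ε) * p) * κ ^ 2) (nhdsWithin 0 (Set.Ioi 0))
        (nhds ((1 - (1 - 0) * p) * κ ^ 2)) :=
      (Continuous.tendsto (by fun_prop) 0).mono_left nhdsWithin_le_nhds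
    have h1 := hcont.eventually (gt_mem_nhds (by simpa using hp))
    have h2 : ∀ᶠ ε : ℝ in nhdsWithin 0 (Set.Ioi 0), ε ∈ Set.Ioc (0 : ℝ) 1 :=
      Ioc_mem_nhdsGT one_pos
    obtain ⟨ε, h3, h4⟩ := (h1.and h2).exists
    exact ⟨ε, h4.1, h4.2, h3⟩
  set q := 1 - (1 - ε) * p with hqdef
  have hq0 : 0 ≤ q := by nlinarith
  -- `a s` is the pathwise cost for a past of length `s + 1`, to be charged to the event that length
  -- `s` did not suffice.
  set a : ℕ → ℝ := fun s => (s + 2) * (κ ^ (s + 1)) ^ 2 with ha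
  have ha0 : ∀ s, 0 ≤ a s := fun s => by positivity
  have hsum : Summable fun s => a s * q ^ s := by
    have hr0 : 0 ≤ q * κ ^ 2 := by positivity
    have hr : ‖q * κ ^ 2‖ < 1 := by rwa [Real.norm_of_nonneg hr0]
    have h1 := (summable_pow_mul_geometric_of_norm_lt_one 1 hr).mul_left (κ ^ 2)
    have h2 := (summable_geometric_of_norm_lt_one hr).mul_left (2 * κ ^ 2)
    refine (h1.add h2).congr fun s => ?_
    simp only [ha, mul_pow, ← pow_mul]
    ring
  have hterm0 : ∀ s, 0 ≤ a s * q ^ s := fun s => mul_nonneg (ha0 s) (pow_nonneg hq0 s)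
  have hbound : ∀ k z ω, quadForm (errorCov A C Q R P₀ (fun t => γ t ω) k) z ≤
      K * ‖z‖ ^ 2 * (1 + (ε ^ H)⁻¹ * ∑ s ∈ Finset.range k,
        a s * ∏ t ∈ Finset.Ico (k - s) k, (1 - (1 - ε) * γ t ω)) := by
    intro k z ω
    set g : ℕ → ℝ := fun t => γ t ω with hgdef
    have hg : ∀ t, g t = 0 ∨ g t = 1 := fun t => hγ.zero_or_one t ω
    let N : ℕ → ℕ := fun s => ((Finset.range s).filter fun t => g (k - s + t) = 1).card
    have hprod : ∀ s ∈ Finset.range k, a s * ∏ t ∈ Finset.Ico (k - s) k, (1 - (1 - ε) * γ t ω) =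
        a s * ε ^ N s := fun s hs => by
      rw [pow_card_arrivals hg (Finset.mem_range.1 hs).le]
    rw [Finset.sum_congr rfl hprod]
    have hnn : ∀ s, 0 ≤ a s * ε ^ N s := fun s => mul_nonneg (ha0 s) (by positivity)
    have hS0 : 0 ≤ ∑ s ∈ Finset.range k, a s * ε ^ N s := Finset.sum_nonneg fun s _ => hnn s
    classical
    -- Take the least admissible length. If it is positive, its predecessor has fewer than `H`
    -- arrivals, so `ε ^ H ≤ ε ^ N s` there: Markov's inequality applied path by path. Length 0 is
    -- covered by the summand 1.
    have hex : ∃ s, s = k ∨ H ≤ N s := ⟨k, Or.inl rfl⟩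
    have hspec := Nat.find_spec hex
    have hle : Nat.find hex ≤ k := Nat.find_min' hex (Or.inl rfl)
    have hmin : ∀ s < Nat.find hex, ¬ (s = k ∨ H ≤ N s) := fun s hs => Nat.find_min hex hs
    generalize Nat.find hex = s at hspec hle hmin
    have hq' := hpath g hg k s hle hspec z
    refine hq'.trans ?_
    rw [mul_right_comm]
    refine mul_le_mul_of_nonneg_left ?_ (by positivity)
    cases s with
    | zero =>
      have : 0 ≤ (ε ^ H)⁻¹ * ∑ s ∈ Finset.range k, a s * ε ^ N s := by positivity
      simpa using this
    | succ s =>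
      have hs := hmin s (Nat.lt_succ_self s)
      push Not at hs
      have h1 : ε ^ H ≤ ε ^ N s := pow_le_pow_of_le_one hε0.le hε1 hs.2.le
      have h2 : a s * ε ^ N s ≤ ∑ s ∈ Finset.range k, a s * ε ^ N s :=
        Finset.single_le_sum (f := fun s => a s * ε ^ N s) (fun s _ => hnn s)
          (Finset.mem_range.2 (by omega))
      have h3 : a s ≤ (ε ^ H)⁻¹ * ∑ s ∈ Finset.range k, a s * ε ^ N s := by
        rw [inv_mul_eq_div, le_div_iff₀ (by positivity)]
        exact (mul_le_mul_of_nonneg_left h1 (ha0 s)).trans h2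
      have h4 : ((s + 1 : ℕ) + 1 : ℝ) * (κ ^ (s + 1)) ^ 2 = a s := by
        simp only [ha]; push_cast; ring
      rw [h4]
      linarith
  have hε' : 0 ≤ (ε ^ H)⁻¹ := by positivity
  refine loewnerBounded_of_quadForm_le hγ hP₀ hQ hR
    (K := K * (1 + (ε ^ H)⁻¹ * ∑' s, a s * q ^ s))
    (mul_nonneg hK (add_nonneg zero_le_one (mul_nonneg hε' (tsum_nonneg hterm0)))) fun k z => ?_
  have hint : Integrable (fun ω => ∑ s ∈ Finset.range k,
      a s * ∏ t ∈ Finset.Ico (k - s) k, (1 - (1 - ε) * γ t ω)) μ :=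
    integrable_finsetSum _ fun s _ => (hγ.integrable_prod _ _).const_mul _
  calc ∫ ω, quadForm (errorCov A C Q R P₀ (fun t => γ t ω) k) z ∂μ
      ≤ ∫ ω, K * ‖z‖ ^ 2 * (1 + (ε ^ H)⁻¹ * ∑ s ∈ Finset.range k,
        a s * ∏ t ∈ Finset.Ico (k - s) k, (1 - (1 - ε) * γ t ω)) ∂μ :=
        integral_mono (hγ.integrable_quadForm A C Q R P₀ k z)
          (((integrable_const _).add (hint.const_mul _)).const_mul _) (hbound k z)
    _ = K * ‖z‖ ^ 2 * (1 + (ε ^ H)⁻¹ * ∑ s ∈ Finset.range k, a s * q ^ s) := by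
        rw [integral_const_mul, integral_add (integrable_const _) (hint.const_mul _),
          integral_const_mul, integral_finsetSum _ fun s _ =>
            (hγ.integrable_prod _ _).const_mul _]
        have : ∀ s ∈ Finset.range k, ∫ ω, a s * ∏ t ∈ Finset.Ico (k - s) k,
            (1 - (1 - ε) * γ t ω) ∂μ = a s * q ^ s := fun s hs => by
          rw [integral_const_mul, hγ.integral_prod hp0, Nat.card_Ico,
            Nat.sub_sub_self (Finset.mem_range.1 hs).le]
        rw [Finset.sum_congr rfl this]
        simp
    _ ≤ K * ‖z‖ ^ 2 * (1 + (ε ^ H)⁻¹ * ∑' s, a s * q ^ s) := by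
        gcongr
        exact hsum.sum_le_tsum _ fun s _ => hterm0 s
    _ = _ := by ring

/-- At and below the critical value the mean error covariance is unbounded. -/
lemma IsDiagonalization.meanUnbounded.{u} (h : IsDiagonalization A S lam)
    (hP₀ : P₀.PosSemidef) (hQ : Q.PosDef) (hR : R.PosDef) (i : Fin n) {p : ℝ} (hp0 : 0 ≤ p)
    (hp : 1 ≤ (1 - p) * ‖lam i‖ ^ 2) : MeanUnbounded.{u} A C Q R P₀ p := by
  have hdet := (Matrix.isUnit_iff_isUnit_det _).1 h.1
  have hleft : S⁻¹ * toC A = Matrix.diagonal lam * S⁻¹ := by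
    rw [← h.2, Matrix.mul_assoc _ S, Matrix.mul_nonsing_inv _ hdet, Matrix.mul_one]
  -- The rows of `S⁻¹` are left eigenvectors of `A`.
  let v : Fin n → ℂ := S⁻¹ i
  have hv : ∀ j, ∑ l, v l * (A l j : ℂ) = lam i * v j := fun j => by
    have := congrFun (congrFun hleft i) j
    rw [Matrix.diagonal_mul, Matrix.mul_apply] at this
    exact this
  have hv0 : v ≠ 0 := fun h0 => by
    have h1 := congrFun (congrFun (Matrix.nonsing_inv_mul S hdet) i) i
    rw [Matrix.mul_apply, Matrix.one_apply_eq] at h1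
    have h2 : ∀ j, S⁻¹ i j = 0 := fun j => congrFun h0 j
    simp [h2] at h1
  refine meanUnbounded_of_eigenvector (a := fun j => (v j).re) (b := fun j => (v j).im)
    (α := (lam i).re) (β := (lam i).im) hP₀ hQ hR ?_ ?_ ?_ hp0 ?_
  · by_contra hcon
    push Not at hcon
    exact hv0 (funext fun j => Complex.ext (congrFun hcon.1 j) (congrFun hcon.2 j))
  · ext j
    have := congrArg Complex.re (hv j)
    simp only [Complex.re_sum, Complex.mul_re, Complex.ofReal_re, Complex.ofReal_im, mul_zero,
      sub_zero] at this
    simp only [Matrix.mulVec, dotProduct, Matrix.transpose_apply, Pi.sub_apply, Pi.smul_apply,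
      smul_eq_mul]
    rw [← this]
    exact Finset.sum_congr rfl fun l _ => mul_comm _ _
  · ext j
    have := congrArg Complex.im (hv j)
    simp only [Complex.im_sum, Complex.mul_im, Complex.ofReal_re, Complex.ofReal_im, mul_zero,
      zero_add] at this
    simp only [Matrix.mulVec, dotProduct, Matrix.transpose_apply, Pi.add_apply, Pi.smul_apply,
      smul_eq_mul]
    rw [add_comm, ← this]
    exact Finset.sum_congr rfl fun l _ => mul_comm _ _
  · rwa [← Complex.normSq_eq_norm_sq, Complex.normSq_apply, ← sq, ← sq] at hp

lemma IsDiagonalization.exists_eq_of_mem_spectrum (h : IsDiagonalization A S lam) {z : ℂ}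
    (hz : z ∈ spectrum ℂ (toC A)) : ∃ i, lam i = z := by
  obtain ⟨U, rfl⟩ := h.1
  have h1 := h.2
  rw [← Matrix.coe_units_inv] at h1
  rw [← spectrum.units_conjugate' (u := U), h1, spectrum_diagonal] at hz
  exact hz

lemma criticalBound_nonneg (z : ℂ) : 0 ≤ criticalBound z := by
  unfold criticalBound
  split_ifs
  · exact le_rfl
  · exact le_max_right _ _

lemma criticalBound_lt_one (z : ℂ) : criticalBound z < 1 := by
  unfold criticalBound
  split_ifs with hz
  · exact one_pos
  · have : 0 < 1 / ‖z‖ ^ 2 := by have := norm_pos_iff.2 hz; positivity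
    exact max_lt (by linarith) one_pos

lemma criticalBound_of_one_lt {z : ℂ} (hz : 1 < ‖z‖) : criticalBound z = 1 - 1 / ‖z‖ ^ 2 := by
  have h0 : z ≠ 0 := by
    rintro rfl
    norm_num at hz
  rw [criticalBound, if_neg h0, max_eq_left]
  have : 1 / ‖z‖ ^ 2 ≤ 1 := by
    rw [div_le_one (by positivity)]
    exact one_le_pow₀ hz.le
  linarith

lemma criticalBound_of_le_one {z : ℂ} (hz : ‖z‖ ≤ 1) : criticalBound z = 0 := by
  unfold criticalBound
  split_ifs with h0
  · rfl
  · have h1 := norm_pos_iff.2 h0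
    refine max_eq_right ?_
    have : 1 ≤ 1 / ‖z‖ ^ 2 := by
      rw [le_div_iff₀ (by positivity), one_mul]
      exact pow_le_one₀ h1.le hz
    linarith

/-- The growth bound used above the threshold must be at least 1; for `‖z‖ ≤ 1` the condition
reduces to `p > 0`. -/
lemma one_sub_mul_max_sq_lt_one {z : ℂ} {p : ℝ} (hp : criticalBound z < p) :
    (1 - p) * max ‖z‖ 1 ^ 2 < 1 := by
  rcases le_or_gt ‖z‖ 1 with hz | hz
  · rw [criticalBound_of_le_one hz] at hp
    rw [max_eq_right hz]
    linarith
  · rw [criticalBound_of_one_lt hz] at hp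
    rw [max_eq_left hz.le, ← lt_div_iff₀ (by positivity)]
    linarith

lemma one_le_one_sub_mul_sq {z : ℂ} (hz : 1 < ‖z‖) {p : ℝ} (hp : p ≤ criticalBound z) :
    1 ≤ (1 - p) * ‖z‖ ^ 2 := by
  rw [criticalBound_of_one_lt hz] at hp
  rw [← div_le_iff₀ (by positivity)]
  linarith

/-- The critical value for any nonempty class of initial covariances. -/
lemma IsDiagonalization.isCriticalValue.{u} (h : IsDiagonalization A S lam)
    (hQ : Q.PosDef) (hR : R.PosDef)
    (hobs : ∀ I : Finset (Fin n), IsEquiBlock lam I → (∀ i ∈ I, 1 ≤ ‖lam i‖) →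
      OneStepObservable (blockOutput (toC C * S) I))
    (i₁ : Fin n) (hdom : ∀ i, ‖lam i‖ ≤ ‖lam i₁‖) {init : Set (Matrix (Fin n) (Fin n) ℝ)}
    (hinit : ∀ P ∈ init, P.PosSemidef) (hne : init.Nonempty) :
    IsCriticalValue.{u} A C Q R init (criticalBound (lam i₁)) where
  nonneg := criticalBound_nonneg _
  lt_one := criticalBound_lt_one _
  unbounded_of_lt p hp0 hp := by
    obtain ⟨P₀, hP₀⟩ := hne
    refine ⟨P₀, hP₀, h.meanUnbounded (hinit _ hP₀) hQ hR i₁ hp0 (one_le_one_sub_mul_sq ?_ hp.le)⟩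
    -- For `‖lam i₁‖ ≤ 1` the threshold is 0 and no `p ≥ 0` lies below it.
    by_contra hle
    rw [criticalBound_of_le_one (not_lt.1 hle)] at hp
    linarith
  unbounded_at hunst := by
    obtain ⟨P₀, hP₀⟩ := hne
    obtain ⟨z, hz, hz1⟩ := hunst
    obtain ⟨i, rfl⟩ := h.exists_eq_of_mem_spectrum hz
    exact ⟨P₀, hP₀, h.meanUnbounded (hinit _ hP₀) hQ hR i₁ (criticalBound_nonneg _)
      (one_le_one_sub_mul_sq (hz1.trans_le (hdom i)) le_rfl)⟩
  bounded_of_gt p hp hp1 P₀ hP₀ :=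
    h.meanBounded (hinit _ hP₀) hQ.posSemidef hR hobs (le_max_right _ 1)
      (fun i => (hdom i).trans (le_max_left _ _)) ((criticalBound_nonneg _).trans hp.le) hp1
      (one_sub_mul_max_sq_lt_one hp)

end Critical

end IntermittentKalman

end

theorem theorem4 {n m : ℕ}
    (A : Matrix (Fin n) (Fin n) ℝ) (C : Matrix (Fin m) (Fin n) ℝ)
    (Q : Matrix (Fin n) (Fin n) ℝ) (R : Matrix (Fin m) (Fin m) ℝ)
    (Sigma0 : Matrix (Fin n) (Fin n) ℝ)
    -- (C, A) is detectable
    (hdet : IntermittentKalman.Detectable A C)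
    -- A can be diagonalized over the complex numbers, with eigenvalues `lam`
    (S : Matrix (Fin n) (Fin n) ℂ) (lam : Fin n → ℂ)
    (hdiag : IntermittentKalman.IsDiagonalization A S lam)
    -- R, Q, Sigma0 are strictly positive definite
    (hR : R.PosDef) (hQ : Q.PosDef) (hSigma0 : Sigma0.PosDef)
    -- the equi-blocks of (S⁻¹ A S, C S) with eigenvalues of modulus at least 1 are non-degenerate
    (hnondeg : ∀ I : Finset (Fin n), IntermittentKalman.IsEquiBlock lam I →
      (∀ i ∈ I, 1 ≤ ‖lam i‖) →
      IntermittentKalman.OneStepObservable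
        (IntermittentKalman.blockOutput (IntermittentKalman.toC C * S) I))
    -- `lam i₁` is a dominant eigenvalue
    (i₁ : Fin n) (hdom : ∀ i, ‖lam i‖ ≤ ‖lam i₁‖) :
    -- critical value of the system with initial covariance `Sigma0`
    IntermittentKalman.IsCriticalValue A C Q R {Sigma0}
        (IntermittentKalman.criticalBound (lam i₁)) ∧
    -- the same value is critical when all initial covariances `P₀ ≥ 0` are considered
    IntermittentKalman.IsCriticalValue A C Q R {P₀ | P₀.PosSemidef}
        (IntermittentKalman.criticalBound (lam i₁)) := by
  exact ⟨hdiag.isCriticalValue hQ hR hnondeg i₁ hdom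
      (fun P hP => by rw [Set.mem_singleton_iff.1 hP]; exact hSigma0.posSemidef)
      (Set.singleton_nonempty _),
    hdiag.isCriticalValue hQ hR hnondeg i₁ hdom (fun _ hP => hP) ⟨Sigma0, hSigma0.posSemidef⟩⟩
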